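/- Let $d\ge 3$ and let $B$ be a smooth, closed, compactly supported real $2$-form on $\mathbb{R}^d$, with coefficients $B_{jk}=-B_{kj}$ in Cartesian coordinates. Let $$A_j(x)=\int_0^1 x^l\,B_{lj}(xu)\,u\,\mathrm{d}u$$ be its magnetic potential in the Poincaré gauge $x\cdot A(x)=0$. For $r>0$ let $\mathsf{A}(\cdot,r)$ be the $1$-form on the unit sphere $S^{d-1}$ obtained by pulling back $A$ along $\sigma\mapsto r\sigma$. Let $\mathrm{d}'$ be the exterior derivative on $S^{d-1}$, let $|\cdot|_{S^{d-1}}$ be the norm of covectors for the round metric $\gamma$ of $S^{d-1}$, let $\mathrm{d}\sigma$ be the surface measure, and set $$\nu_B(r)=\inf_{\varphi\in H^1(S^{d-1};\mathbb{C}),\ \varphi\neq0}\ \frac{\int_{S^{d-1}}\big|(\mathrm{d}'-i\mathsf{A}(\sigma,r))\varphi(\sigma)\big|_{S^{d-1}}^2\,\mathrm{d}\sigma}{\int_{S^{d-1}}|\varphi(\sigma)|^2\,\mathrm{d}\sigma}.$$ Let $\theta^1,\dots,\theta^{d-1}$ be local coordinates on $S^{d-1}$, let $q=(\theta^1,\dots,\theta^{d-1},r)$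 be the corresponding spherical coordinates of $\mathbb{R}^d\setminus\{0\}$ (via $x=r\sigma$), with Euclidean metric $g$, and let $\mathsf{B}_{jk}$ be the components of $B$ in the coordinates $q$. For every fixed $r\in(0,\infty)$ the following statements are equivalent: (i) $\nu_B(r)=0$. (ii) The system $\mathrm{d}'\varphi-i\mathsf{A}(\cdot,r)\varphi=0$ on $S^{d-1}$ has a smooth complex-valued solution $\varphi\neq0$. (iii) $\mathsf{A}(\cdot,r)$ is exact on $S^{d-1}$: $\mathsf{A}(\cdot,r)=\mathrm{d}'f$ for some smooth function $f:S^{d-1}\to\mathbb{R}$. (iv) $\mathsf{A}(\cdot,r)$ is closed on $S^{d-1}$: $\mathsf{B}'(\cdot,r):=\mathrm{d}'\mathsf{A}(\cdot,r)=0$. (v) The Hodge dual of $\mathsf{B}'(\cdot,r)$ on $S^{d-1}$ vanishes: ${}^{*}\mathsf{B}'^{\lambda_1\dots\lambda_{d-3}}(\cdot,r)=\frac1{2!}\,\varepsilon^{\lambda_1\dots\lambda_{d-3}\mu\nu}\,\mathsf{B}'_{\mu\nu}(\cdot,r)=0$ on $S^{d-1}$ for all $\lambda_1,\dots,\lambda_{d-3}\in\{1,\dots,d-1\}$,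 where $\varepsilon$ is the Levi-Civita tensor of $(S^{d-1},\gamma)$. (vi) The radial components of the Hodge dual of $B$ in $\mathbb{R}^d$ vanish on the sphere of radius $r$: in the coordinates $q$, ${}^{*}\mathsf{B}^{\lambda_1\dots\lambda_{d-3}d}(\cdot,r)=\frac1{2!}\,\varepsilon^{\lambda_1\dots\lambda_{d-3}\,d\,jk}\,\mathsf{B}_{jk}(\cdot,r)=0$ for all $\lambda_1,\dots,\lambda_{d-3}\in\{1,\dots,d-1\}$, where $\varepsilon$ is the Levi-Civita tensor of $g$. Moreover, the limit $\nu_B(\infty):=\lim_{r\to\infty}\nu_B(r)$ exists and equals $0$. -/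

import Mathlib

open scoped Manifold ContDiff Topology

noncomputable section

namespace MagneticField

open MeasureTheory

/-- Euclidean space `ℝ^d` with `d = n + 1`. -/
abbrev Space (n : ℕ) : Type := EuclideanSpace ℝ (Fin (n + 1))

/-- The unit sphere `S^{d-1}`, a smooth manifold of dimension `n = d - 1`. -/
abbrev Sph (n : ℕ) : Type := Metric.sphere (0 : Space n) 1

/-- The magnetic potential in the Poincare gauge,
`A(x)(v) = ∫₀¹ u * B(u x)(x, v) du`, that is `A_j(x) = ∫₀¹ x^l B_{lj}(x u) u du`. -/
def potential {n : ℕ} (B : Space n → Space n [⋀^Fin 2]→L[ℝ] ℝ) (x : Space n) :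
    Space n →L[ℝ] ℝ :=
  ∫ u in (0 : ℝ)..1, u • (B (u • x)).toContinuousLinearMap ![x, 0] 1

/-- The spherical coordinate map `σ ↦ r σ` from the sphere to `ℝ^d`, for a fixed radius `r`. -/
def dilate {n : ℕ} (r : ℝ) (σ : Sph n) : Space n := r • (σ : Space n)

/-- The covariant vector field `𝖠(·, r)` on the sphere: the pull-back of `A` along `σ ↦ r σ`. -/
def sphPotential {n : ℕ} (B : Space n → Space n [⋀^Fin 2]→L[ℝ] ℝ) (r : ℝ) (σ : Sph n) :
    TangentSpace (𝓡 n) σ →L[ℝ] ℝ :=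
  (potential B (dilate r σ)).comp (mvfderiv (𝓡 n) (dilate r) σ)

/-! ### Local coordinates on the sphere

`TangentSpace (𝓡 n) σ` is the model space `ℝ^n`, identified with the tangent space of the sphere
through the chart `θ = chartAt σ`; the coordinate vector field `∂/∂θ^μ` at `σ` is therefore
the `μ`-th standard basis vector. -/

/-- The coordinate vector `∂/∂θ^μ` at `σ`. -/
def coordVec {n : ℕ} (σ : Sph n) (μ : Fin n) : TangentSpace (𝓡 n) σ :=
  EuclideanSpace.single μ (1 : ℝ)

/-- The inclusion of the tangent space of the sphere at `σ` into `ℝ^d`. -/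
def tangentIncl {n : ℕ} (σ : Sph n) : TangentSpace (𝓡 n) σ →L[ℝ] Space n :=
  mvfderiv (𝓡 n) ((↑) : Sph n → Space n) σ

/-- The round metric `γ_{μν} = ∂_μ σ · ∂_ν σ`. -/
def roundMetric {n : ℕ} (σ : Sph n) : Matrix (Fin n) (Fin n) ℝ :=
  Matrix.of fun μ ν => inner ℝ (tangentIncl σ (coordVec σ μ)) (tangentIncl σ (coordVec σ ν))

/-- The squared norm `|α|² = α_μ γ^{μν} conj(α_ν)` of a complex covector at `σ`. -/
def covectorNormSq {n : ℕ} (σ : Sph n) (α : TangentSpace (𝓡 n) σ →L[ℝ] ℂ) : ℝ :=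
  ∑ μ, ∑ ν, (roundMetric σ)⁻¹ μ ν *
    (α (coordVec σ μ) * (starRingEnd ℂ) (α (coordVec σ ν))).re

/-! ### The number `ν_B(r)` -/

/-- The surface measure on the sphere. -/
def surfaceMeasure (n : ℕ) : Measure (Sph n) := (volume : Measure (Space n)).toSphere

/-- `(d' - i𝖠(·,r))φ` at `σ`, for a function with value `z` and differential `α` at `σ`. -/
def magneticDiff {n : ℕ} (B : Space n → Space n [⋀^Fin 2]→L[ℝ] ℝ) (r : ℝ) (σ : Sph n)
    (z : ℂ) (α : TangentSpace (𝓡 n) σ →L[ℝ] ℂ) : TangentSpace (𝓡 n) σ →L[ℝ] ℂ :=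
  α - (Complex.I * z) • Complex.ofRealCLM.comp (sphPotential B r σ)

/-- The covector field on the sphere obtained by restricting `G σ` to the tangent space at `σ`.
(Every covector field is of this form.) -/
def restrictTangent {n : ℕ} (G : Sph n → Space n →L[ℝ] ℂ) (σ : Sph n) :
    TangentSpace (𝓡 n) σ →L[ℝ] ℂ :=
  (G σ).comp (tangentIncl σ)

/-- `φ ∈ H^1(S^{d-1})` with `d'φ` the covector field induced by `G`.
The Sobolev space is the completion of the smooth functions in the `H^1` norm, realised in `L²`:
there are smooth `ψ k` with `ψ k → φ` and `d'ψ k → d'φ` in `L²`. -/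
def IsSobolev {n : ℕ} (φ : Sph n → ℂ) (G : Sph n → Space n →L[ℝ] ℂ) : Prop :=
  MemLp φ 2 (surfaceMeasure n) ∧ MemLp G 2 (surfaceMeasure n) ∧
  ∃ ψ : ℕ → Sph n → ℂ, (∀ k, ContMDiff (𝓡 n) 𝓘(ℝ, ℂ) ∞ (ψ k)) ∧
    Filter.Tendsto (fun k => ∫⁻ σ, ENNReal.ofReal (‖ψ k σ - φ σ‖ ^ 2) ∂(surfaceMeasure n))
      Filter.atTop (𝓝 0) ∧
    Filter.Tendsto
      (fun k => ∫⁻ σ, ENNReal.ofReal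
        (covectorNormSq σ (mvfderiv (𝓡 n) (ψ k) σ - restrictTangent G σ)) ∂(surfaceMeasure n))
      Filter.atTop (𝓝 0)

/-- `ν_B(r)`: the infimum of `∫ |(d' - i𝖠(σ,r))φ|² dσ / ∫ |φ|² dσ` over the nonzero
`φ ∈ H^1(S^{d-1})`. -/
def nu {n : ℕ} (B : Space n → Space n [⋀^Fin 2]→L[ℝ] ℝ) (r : ℝ) : ℝ :=
  sInf {q : ℝ | ∃ (φ : Sph n → ℂ) (G : Sph n → Space n →L[ℝ] ℂ),
    IsSobolev φ G ∧ ¬ (φ =ᵐ[surfaceMeasure n] 0) ∧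
    q = (∫ σ, covectorNormSq σ (magneticDiff B r σ (φ σ) (restrictTangent G σ))
          ∂(surfaceMeasure n)) /
        (∫ σ, ‖φ σ‖ ^ 2 ∂(surfaceMeasure n))}

/-! ### Exterior derivative of a 1-form on the sphere -/

/-- The representation of a 1-form `α` on the sphere in the chart at `p`: its pull-back along
the inverse of the (stereographic) chart, whose target is the whole of `ℝ^n`. -/
def chartRep {n : ℕ} (α : ∀ σ : Sph n, TangentSpace (𝓡 n) σ →L[ℝ] ℝ) (p : Sph n)
    (y : EuclideanSpace ℝ (Fin n)) : EuclideanSpace ℝ (Fin n) [⋀^Fin 1]→L[ℝ] ℝ :=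
  ContinuousAlternatingMap.ofSubsingleton ℝ (EuclideanSpace ℝ (Fin n)) ℝ (0 : Fin 1)
    ((α ((chartAt (EuclideanSpace ℝ (Fin n)) p).symm y)).comp
      (mfderiv 𝓘(ℝ, EuclideanSpace ℝ (Fin n)) (𝓡 n)
        (chartAt (EuclideanSpace ℝ (Fin n)) p).symm y))

/-- The exterior derivative `d'α` at `σ`, computed in the chart at `σ`. -/
def sphExtDeriv {n : ℕ} (α : ∀ σ : Sph n, TangentSpace (𝓡 n) σ →L[ℝ] ℝ) (σ : Sph n) :
    TangentSpace (𝓡 n) σ [⋀^Fin 2]→L[ℝ] ℝ :=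
  extDeriv (chartRep α σ) (chartAt (EuclideanSpace ℝ (Fin n)) σ σ)

/-- The magnetic tensor `𝖡'(·, r) = d'𝖠(·, r)` on the sphere. -/
def sphField {n : ℕ} (B : Space n → Space n [⋀^Fin 2]→L[ℝ] ℝ) (r : ℝ) (σ : Sph n) :
    TangentSpace (𝓡 n) σ [⋀^Fin 2]→L[ℝ] ℝ :=
  sphExtDeriv (sphPotential B r) σ

/-! ### Hodge duals -/

/-- The Levi-Civita permutation symbol `δ^{f 0, …, f (N-1)}`: the sign of `f` if `f` is
a permutation, and `0` otherwise. -/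
def leviCivita {N : ℕ} (f : Fin N → Fin N) : ℝ :=
  Matrix.det (Matrix.of fun i j : Fin N => if f i = j then (1 : ℝ) else 0)

/-- The contravariant components
`*β^{l₁ … l_k} = (1/2!) ε^{l₁ … l_k i j} β_{ij}` of the Hodge dual of a 2-form `β` in dimension
`k + 2`, with `ε^{…} = s |g|^{-1/2} δ^{…}` the Levi-Civita tensor of the metric `g`, where
`s = 1` for coordinates that are positively oriented and `s = -1` otherwise. -/
def hodgeDual {k : ℕ} (s : ℝ) (g β : Matrix (Fin (k + 2)) (Fin (k + 2)) ℝ)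
    (l : Fin k → Fin (k + 2)) : ℝ :=
  (1 / 2) * ∑ i, ∑ j, s * (Real.sqrt g.det)⁻¹ *
    leviCivita (Fin.snoc (Fin.snoc l i) j : Fin (k + 2) → Fin (k + 2)) * β i j

/-- The coordinate frame of the spherical coordinates `(θ^1, …, θ^{d-1}, r)` at the point `r σ`
(the rows of `∇ℒ`): the vectors `r ∂_μ σ` and, in the last position, `σ`. -/
def sphericalFrame {n : ℕ} (r : ℝ) (σ : Sph n) : Fin (n + 1) → Space n :=
  Fin.snoc (fun μ => r • tangentIncl σ (coordVec σ μ)) (σ : Space n)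

/-- The orientation (`1` or `-1`) of the spherical coordinates `(θ, r)` at `σ` relative to the
Cartesian ones; the sphere is oriented so that this is also the orientation of `θ`. -/
def orientationSign {n : ℕ} (σ : Sph n) : ℝ :=
  Real.sign (Matrix.det (Matrix.of fun j k : Fin (n + 1) => sphericalFrame 1 σ j k))

/-- The components of the `S^{d-1}` Hodge dual of `𝖡'(·, r)`, where `d = m + 3`. -/
def sphHodge {m : ℕ} (B : Space (m + 2) → Space (m + 2) [⋀^Fin 2]→L[ℝ] ℝ) (r : ℝ)
    (σ : Sph (m + 2)) (l : Fin m → Fin (m + 2)) : ℝ :=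
  hodgeDual (orientationSign σ) (roundMetric σ)
    (Matrix.of fun μ ν => sphField B r σ ![coordVec σ μ, coordVec σ ν]) l

/-- The components, in the spherical coordinates `(θ, r)`, of the `ℝ^d` Hodge dual of the magnetic
tensor `𝖡_{jk} = B(r σ)(b_j, b_k)` at `r σ`, where `b` is the coordinate frame with metric
`g_{jk} = b_j · b_k`, and `d = m + 3`. -/
def spaceHodge {m : ℕ} (B : Space (m + 2) → Space (m + 2) [⋀^Fin 2]→L[ℝ] ℝ) (r : ℝ)
    (σ : Sph (m + 2)) (l : Fin (m + 1) → Fin (m + 3)) : ℝ :=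
  hodgeDual (k := m + 1) (orientationSign σ)
    (Matrix.of fun j k => inner ℝ (sphericalFrame r σ j) (sphericalFrame r σ k))
    (Matrix.of fun j k => B (dilate r σ) ![sphericalFrame r σ j, sphericalFrame r σ k]) l

end MagneticField

end

/-!
On the sphere of radius `r` everything is expressed through an ambient 1-form, the pull-back
`scaledPotential B r` of the magnetic potential along `x ↦ r x`. The Poincaré lemma
(`fderiv_potential_sub`) identifies its exterior derivative, so `sphField B r` is `r²` times the
restriction of the field to the sphere (`sphField_apply`). In the stereographic chart centred at a
point the coordinate vectors are orthonormal there, and a 2-form can be read off its Hodge dual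
component by component (`sum_leviCivita`); this gives the equivalence of the vanishing of `sphField`
with the two statements on Hodge duals. The radial index in the ambient dual removes exactly
the components of the field that are not tangent to the sphere.

A closed 1-form on the sphere is exact (`exists_primitive`): it has a primitive on each of two
stereographic charts with opposite centres, and the overlap of the charts is connected. If
`f` is a primitive of the potential, `exp (i f)` is covariantly constant, and a covariantly constant
function makes the quadratic form vanish.

The remaining implication, from `nu B r = 0` to the vanishing of the field, is proved in
contrapositive form, without compactness of the Sobolev embedding. Suppose the exterior derivative
of the potential `α` is not zero at `σ`, say in the plane of the tangent vectors `u` and `v`. The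
holonomy of `d - i α` around a circle of angular radius `ε` about `σ` is asymptotic to the area
times the value of the exterior derivative, so some small circle has a nontrivial holonomy
(`fderiv_symm_of_holonomy`). The circle is an orbit of the rotations in the plane of `u` and `v`.
Parallel transport along the orbits of rotations by a fixed angle moves a function `ψ` in `L²` by at
most the angle times the square root of the energy of `ψ`, since rotations preserve the surface
measure (`integral_transport_sub_le`). Two consequences: near a point with nontrivial holonomy,
where transport by a full turn multiplies `ψ` by a phase different from one, the mass of `ψ` is
controlled by its energy (`exists_isDispersive_nhds`); and such a control is carried from a set to
its preimage under a rotation (`IsDispersive.preimage`). As rotations act transitively and the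
sphere is compact, the mass on the whole sphere is controlled by the energy
(`exists_spectral_gap`). The bound passes from smooth functions to `H¹` by approximation
(`mass_le_of_isSobolev`), so `nu B r` is positive.

Finally, for `r` beyond the support of the field `sphField B r` vanishes, hence `nu B r = 0` for all
large `r`.
-/

noncomputable section

namespace MagneticField

open MeasureTheory

/-! ### The tangent spaces of the sphere -/

/-- The inverse of the stereographic chart at `p`, as a map into the ambient space. -/
def chartParam {n : ℕ} (p : Sph n) (y : EuclideanSpace ℝ (Fin n)) : Space n :=
  ((chartAt (EuclideanSpace ℝ (Fin n)) p).symm y : Space n)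

section Geometry

variable {n : ℕ}

lemma norm_sphere (σ : Sph n) : ‖(σ : Space n)‖ = 1 := by simp

/-- The linear isometry identifying the model space with the hyperplane tangent at `p`. -/
def modelIsometry (p : Sph n) : EuclideanSpace ℝ (Fin n) →ₗᵢ[ℝ] Space n :=
  haveI := Fact.mk (@finrank_euclideanSpace_fin ℝ _ (n + 1))
  (ℝ ∙ ((-p : Sph n) : Space n))ᗮ.subtypeₗᵢ.comp
    (OrthonormalBasis.fromOrthogonalSpanSingleton n
      (ne_zero_of_mem_unit_sphere (-p))).repr.symm.toLinearIsometry

lemma chartParam_eq (p : Sph n) :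
    chartParam p = stereoInvFunAux ((-p : Sph n) : Space n) ∘ modelIsometry p := rfl

lemma contDiff_chartParam (p : Sph n) : ContDiff ℝ ∞ (chartParam p) := by
  rw [chartParam_eq]
  exact contDiff_stereoInvFunAux.comp (modelIsometry p).contDiff

lemma hasFDerivAt_chartParam_zero (p : Sph n) :
    HasFDerivAt (chartParam p) (modelIsometry p).toContinuousLinearMap 0 := by
  rw [chartParam_eq]
  have h : HasFDerivAt (stereoInvFunAux ((-p : Sph n) : Space n))
      (ContinuousLinearMap.id ℝ (Space n)) (modelIsometry p 0) := by
    simpa only [map_zero] using hasFDerivAt_stereoInvFunAux ((-p : Sph n) : Space n)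
  exact h.comp 0 (modelIsometry p).toContinuousLinearMap.hasFDerivAt

lemma chartParam_injective (p : Sph n) : Function.Injective (chartParam p) := by
  intro x y h
  have h' := Subtype.ext h
  have ht : (chartAt (EuclideanSpace ℝ (Fin n)) p).target = Set.univ := by
    simp [chartAt, ChartedSpace.chartAt]
  have := congrArg (chartAt (EuclideanSpace ℝ (Fin n)) p) h'
  rwa [OpenPartialHomeomorph.right_inv _ (by simp [ht]),
    OpenPartialHomeomorph.right_inv _ (by simp [ht])] at this

lemma chartAt_target (p : Sph n) :
    (chartAt (EuclideanSpace ℝ (Fin n)) p).target = Set.univ := by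
  simp [chartAt, ChartedSpace.chartAt]

lemma chartAt_source (p : Sph n) :
    (chartAt (EuclideanSpace ℝ (Fin n)) p).source = {-p}ᶜ := by
  simp [chartAt, ChartedSpace.chartAt]

lemma chartParam_chartAt (p : Sph n) {σ : Sph n} (h : σ ≠ -p) :
    chartParam p (chartAt (EuclideanSpace ℝ (Fin n)) p σ) = σ := by
  unfold chartParam
  rw [OpenPartialHomeomorph.left_inv _ (by simpa [chartAt_source] using h)]

lemma self_ne_neg (p : Sph n) : p ≠ -p := ne_neg_of_mem_unit_sphere ℝ p

lemma chartAt_self (p : Sph n) : chartAt (EuclideanSpace ℝ (Fin n)) p p = 0 := by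
  apply chartParam_injective p
  rw [chartParam_chartAt p (self_ne_neg p), chartParam_eq]
  simp

lemma contMDiff_coe (m : ℕ∞ω) :
    ContMDiff (𝓡 n) 𝓘(ℝ, Space n) m ((↑) : Sph n → Space n) :=
  haveI := Fact.mk (@finrank_euclideanSpace_fin ℝ _ (n + 1))
  contMDiff_coe_sphere

lemma hasMFDerivAt_coe (σ : Sph n) :
    HasMFDerivAt (𝓡 n) 𝓘(ℝ, Space n) ((↑) : Sph n → Space n) σ (tangentIncl σ) :=
  ((contMDiff_coe 1 σ).mdifferentiableAt one_ne_zero).hasMFDerivAt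

/-- Since the chart at `σ` is stereographic, centred at `σ`, the identification of the model space
with the tangent space at `σ` is isometric; in particular the round metric is the identity matrix.
-/
lemma tangentIncl_eq (σ : Sph n) :
    tangentIncl σ = (modelIsometry σ).toContinuousLinearMap := by
  have h := (hasMFDerivAt_coe σ).2
  let T : EuclideanSpace ℝ (Fin n) →L[ℝ] Space n := tangentIncl σ
  have h1 : HasFDerivWithinAt (chartParam σ) T (Set.range (𝓡 n))
      (chartAt (EuclideanSpace ℝ (Fin n)) σ σ) := h
  have hr : Set.range (𝓡 n) = Set.univ := by simp
  rw [hr, hasFDerivWithinAt_univ, chartAt_self] at h1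
  exact h1.unique (hasFDerivAt_chartParam_zero σ)

lemma tangentIncl_apply (σ : Sph n) (v : EuclideanSpace ℝ (Fin n)) :
    tangentIncl σ v = modelIsometry σ v := by
  rw [tangentIncl_eq]; rfl

lemma inner_tangentIncl (σ : Sph n) (v w : EuclideanSpace ℝ (Fin n)) :
    inner ℝ (tangentIncl σ v) (tangentIncl σ w) = inner ℝ v w := by
  rw [tangentIncl_apply, tangentIncl_apply]
  exact (modelIsometry σ).inner_map_map v w

lemma range_tangentIncl (σ : Sph n) :
    (tangentIncl σ).range = (ℝ ∙ (σ : Space n))ᗮ :=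
  haveI := Fact.mk (@finrank_euclideanSpace_fin ℝ _ (n + 1))
  range_mvfderiv_subtypeVal σ

lemma inner_self_tangentIncl (σ : Sph n) (v : EuclideanSpace ℝ (Fin n)) :
    inner ℝ (σ : Space n) (tangentIncl σ v) = 0 := by
  have : tangentIncl σ v ∈ (ℝ ∙ (σ : Space n))ᗮ := by
    rw [← range_tangentIncl]; exact ⟨v, rfl⟩
  exact Submodule.mem_orthogonal_singleton_iff_inner_right.mp this

lemma exists_tangentIncl_eq (σ : Sph n) {w : Space n} (hw : inner ℝ (σ : Space n) w = 0) :
    ∃ v : EuclideanSpace ℝ (Fin n), tangentIncl σ v = w := by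
  have : w ∈ (tangentIncl σ).range := by
    rw [range_tangentIncl]
    exact Submodule.mem_orthogonal_singleton_iff_inner_right.mpr hw
  exact this

lemma roundMetric_eq_one (σ : Sph n) : roundMetric σ = 1 := by
  ext μ ν
  simp only [roundMetric, Matrix.of_apply, coordVec]
  rw [inner_tangentIncl]
  simp [Matrix.one_apply, EuclideanSpace.inner_single_left]

/-- The coordinate vectors at `σ` are orthonormal, so the norm of a covector is a sum of squares. -/
lemma covectorNormSq_eq (σ : Sph n) (α : TangentSpace (𝓡 n) σ →L[ℝ] ℂ) :
    covectorNormSq σ α = ∑ μ, ‖α (coordVec σ μ)‖ ^ 2 := by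
  simp only [covectorNormSq, roundMetric_eq_one, inv_one]
  refine Finset.sum_congr rfl fun μ _ => ?_
  rw [Finset.sum_eq_single μ]
  · simp only [Complex.mul_conj, Complex.normSq_eq_norm_sq, Matrix.one_apply_eq, one_mul,
      Complex.ofReal_re]
  · intro ν _ h
    simp [h.symm]
  · simp

lemma hasMFDerivAt_comp_coe {F : Type*} [NormedAddCommGroup F] [NormedSpace ℝ F]
    {g : Space n → F} {g' : Space n →L[ℝ] F} (σ : Sph n) (hg : HasFDerivAt g g' σ) :
    HasMFDerivAt (𝓡 n) 𝓘(ℝ, F) (fun τ : Sph n => g τ) σ (g'.comp (tangentIncl σ)) :=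
  hg.hasMFDerivAt.comp σ (hasMFDerivAt_coe σ)

lemma mvfderiv_comp_coe {F : Type*} [NormedAddCommGroup F] [NormedSpace ℝ F]
    {g : Space n → F} {g' : Space n →L[ℝ] F} (σ : Sph n) (hg : HasFDerivAt g g' σ) :
    mvfderiv (𝓡 n) (fun τ : Sph n => g τ) σ = g'.comp (tangentIncl σ) :=
  (hasMFDerivAt_comp_coe σ hg).mfderiv

end Geometry

/-! ### Integrals depending on a parameter -/

section Parametric

variable {E V : Type} [NormedAddCommGroup E] [NormedSpace ℝ E] [ProperSpace E]
  [NormedAddCommGroup V] [NormedSpace ℝ V]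

lemma hasFDerivAt_parametric_integral {G : E × ℝ → V} (hG : ContDiff ℝ 1 G) (a b : ℝ) (x : E) :
    HasFDerivAt (fun x => ∫ u in a..b, G (x, u))
      (∫ u in a..b, (fderiv ℝ G (x, u)).comp (ContinuousLinearMap.inl ℝ E ℝ)) x := by
  have hc : Continuous fun p : E × ℝ =>
      (fderiv ℝ G p).comp (ContinuousLinearMap.inl ℝ E ℝ) :=
    (hG.continuous_fderiv one_ne_zero).clm_comp continuous_const
  obtain ⟨C, hC⟩ := ((isCompact_closedBall x 1).prod
    (isCompact_uIcc (a := a) (b := b))).exists_bound_of_continuousOn hc.continuousOn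
  refine intervalIntegral.hasFDerivAt_integral_of_dominated_of_fderiv_le
    (F' := fun x u => (fderiv ℝ G (x, u)).comp (ContinuousLinearMap.inl ℝ E ℝ))
    (bound := fun _ => C) (Metric.closedBall_mem_nhds x one_pos) ?_ ?_ ?_ ?_ ?_ ?_
  · exact Filter.Eventually.of_forall fun y =>
      (hG.continuous.comp (by fun_prop : Continuous fun u => (y, u))).aestronglyMeasurable
  · exact (hG.continuous.comp (by fun_prop : Continuous fun u => (x, u))).intervalIntegrable _ _
  · exact (hc.comp (by fun_prop : Continuous fun u => (x, u))).aestronglyMeasurable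
  · exact Filter.Eventually.of_forall fun t ht y hy => hC (y, t) ⟨hy, Set.uIoc_subset_uIcc ht⟩
  · exact intervalIntegrable_const
  · refine Filter.Eventually.of_forall fun t _ y _ => ?_
    exact ((hG.differentiable one_ne_zero (y, t)).hasFDerivAt).comp y (hasFDerivAt_prodMk_left y t)

/-- Integrals depending smoothly on a parameter are smooth. -/
lemma contDiff_parametric_integral {G : E × ℝ → V} (hG : ContDiff ℝ ∞ G) (a b : ℝ) :
    ContDiff ℝ ∞ (fun x => ∫ u in a..b, G (x, u)) := by
  rw [contDiff_infty]
  intro k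
  induction k generalizing V with
  | zero =>
    rw [Nat.cast_zero, contDiff_zero]
    refine continuous_iff_continuousAt.2 fun x => ?_
    exact (hasFDerivAt_parametric_integral (hG.of_le (by simp)) a b x).continuousAt
  | succ k ih =>
    push_cast
    rw [contDiff_succ_iff_fderiv]
    refine ⟨fun x =>
      (hasFDerivAt_parametric_integral (hG.of_le (by simp)) a b x).differentiableAt, by simp, ?_⟩
    have := ih (G := fun p : E × ℝ => (fderiv ℝ G p).comp (ContinuousLinearMap.inl ℝ E ℝ))
      ((hG.fderiv_right (m := ∞) (by simp)).clm_comp contDiff_const)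
    convert this using 2 with x
    exact (hasFDerivAt_parametric_integral (hG.of_le (by simp)) a b x).fderiv

end Parametric

section Compositions

variable {E V W : Type*} [NormedAddCommGroup E] [NormedSpace ℝ E]
  [NormedAddCommGroup V] [NormedSpace ℝ V] [NormedAddCommGroup W] [NormedSpace ℝ W]

lemma fderiv_clm_comp_left (L : V →L[ℝ] W) {f : E → V} {x : E} (hf : DifferentiableAt ℝ f x) :
    fderiv ℝ (fun y => L (f y)) x = L.comp (fderiv ℝ f x) :=
  (L.hasFDerivAt.comp x hf.hasFDerivAt).fderiv

lemma contDiff_clm_comp_left (L : V →L[ℝ] W) {f : E → V} (hf : ContDiff ℝ ∞ f) :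
    ContDiff ℝ ∞ fun y => L (f y) :=
  L.contDiff.comp hf

lemma hasFDerivAt_comp_dilation {f : E → V} {u : ℝ} {x : E} (hf : DifferentiableAt ℝ f (u • x)) :
    HasFDerivAt (fun y => f (u • y))
      ((fderiv ℝ f (u • x)).comp (u • ContinuousLinearMap.id ℝ E)) x :=
  HasFDerivAt.comp (f := fun y : E => u • y) x hf.hasFDerivAt ((hasFDerivAt_id x).const_smul u)

lemma hasDerivAt_comp_ray {f : E → V} {u : ℝ} {x : E} (hf : DifferentiableAt ℝ f (u • x)) :
    HasDerivAt (fun s : ℝ => f (s • x)) (fderiv ℝ f (u • x) x) u := by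
  have := HasFDerivAt.comp_hasDerivAt (f := fun s : ℝ => s • x) u hf.hasFDerivAt
    ((hasDerivAt_id u).smul_const x)
  rwa [one_smul] at this

/-- The derivative of the integrand of the potential in the Poincaré gauge. -/
lemma hasFDerivAt_radial {f : E → E →L[ℝ] V} {u : ℝ} {x : E}
    (hf : DifferentiableAt ℝ f (u • x)) :
    HasFDerivAt (fun y => u • f (u • y) y)
      (u • (f (u • x) + ((fderiv ℝ f (u • x)).comp (u • ContinuousLinearMap.id ℝ E)).flip x)) x :=
  HasFDerivAt.const_smul
    ((hasFDerivAt_comp_dilation (V := E →L[ℝ] V) hf).clm_apply (hasFDerivAt_id x)) u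

end Compositions

/-! ### Differential forms of degree one and two -/

section Forms

variable {E : Type} [NormedAddCommGroup E] [NormedSpace ℝ E]

/-- A 2-form, regarded as a bilinear form. -/
def bilin : (E [⋀^Fin 2]→L[ℝ] ℝ) →L[ℝ] (E →L[ℝ] E →L[ℝ] ℝ) :=
  (ContinuousLinearMap.compL ℝ E (E [⋀^Fin 1]→L[ℝ] ℝ) (E →L[ℝ] ℝ)
    ((ContinuousAlternatingMap.ofSubsingletonLIE (𝕜 := ℝ) (E := E) (F := ℝ)
      (0 : Fin 1)).symm.toContinuousLinearEquiv : (E [⋀^Fin 1]→L[ℝ] ℝ) →L[ℝ] (E →L[ℝ] ℝ))).comp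
    (ContinuousAlternatingMap.curryLeftLI (𝕜 := ℝ) (E := E) (F := ℝ) (n := 1)).toContinuousLinearMap

lemma bilin_apply (β : E [⋀^Fin 2]→L[ℝ] ℝ) (v w : E) : bilin β v w = β ![v, w] := by
  change β (Matrix.vecCons v fun _ => w) = β ![v, w]
  congr 1
  ext i; fin_cases i <;> rfl

lemma bilin_swap (β : E [⋀^Fin 2]→L[ℝ] ℝ) (v w : E) : bilin β w v = -bilin β v w := by
  have := β.toAlternatingMap.map_swap ![v, w] (i := 0) (j := 1) (by decide)
  rw [bilin_apply, bilin_apply]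
  refine Eq.trans ?_ this
  change β _ = β _
  congr 1
  ext i; fin_cases i <;> rfl

/-- A covector field, regarded as a 1-form. -/
def oneForm (α : E → E →L[ℝ] ℝ) (x : E) : E [⋀^Fin 1]→L[ℝ] ℝ :=
  ContinuousAlternatingMap.ofSubsingleton ℝ E ℝ (0 : Fin 1) (α x)

lemma oneForm_apply (α : E → E →L[ℝ] ℝ) (x : E) (v : Fin 1 → E) :
    oneForm α x v = α x (v 0) := rfl

lemma differentiableAt_oneForm {α : E → E →L[ℝ] ℝ} {x : E} (h : DifferentiableAt ℝ α x) :
    DifferentiableAt ℝ (oneForm α) x :=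
  (ContinuousAlternatingMap.ofSubsingletonLIE (𝕜 := ℝ) (E := E) (F := ℝ)
    (0 : Fin 1)).toContinuousLinearEquiv.differentiableAt.comp x h

lemma extDeriv_oneForm {α : E → E →L[ℝ] ℝ} {x : E} (h : DifferentiableAt ℝ α x) (v w : E) :
    extDeriv (oneForm α) x ![v, w] = fderiv ℝ α x v w - fderiv ℝ α x w v := by
  rw [extDeriv_apply (differentiableAt_oneForm h), Fin.sum_univ_two]
  simp only [oneForm_apply]
  have (u : E) : fderiv ℝ (fun y => α y u) x =
      (ContinuousLinearMap.apply ℝ ℝ u).comp (fderiv ℝ α x) :=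
    ((ContinuousLinearMap.apply ℝ ℝ u).hasFDerivAt.comp x h.hasFDerivAt).fderiv
  simp [this, Fin.removeNth, sub_eq_add_neg]

/-- The exterior derivative of a 2-form is the cyclic sum of its derivatives. -/
lemma extDeriv_twoForm (B : E → E [⋀^Fin 2]→L[ℝ] ℝ) (x a b c : E) :
    extDeriv B x ![a, b, c] = bilin (fderiv ℝ B x a) b c - bilin (fderiv ℝ B x b) a c
      + bilin (fderiv ℝ B x c) a b := by
  rw [extDeriv, ContinuousAlternatingMap.alternatizeUncurryFin_apply, Fin.sum_univ_three]
  have h0 : (0 : Fin 3).removeNth ![a, b, c] = ![b, c] := by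
    ext i; fin_cases i <;> rfl
  have h1 : (1 : Fin 3).removeNth ![a, b, c] = ![a, c] := by
    ext i; fin_cases i <;> rfl
  have h2 : (2 : Fin 3).removeNth ![a, b, c] = ![a, b] := by
    ext i; fin_cases i <;> rfl
  rw [h0, h1, h2]
  simp [sub_eq_add_neg, bilin_apply]

/-- The derivative of the bilinear form of a closed 2-form satisfies the Bianchi identity. -/
lemma fderiv_bilin_of_closed {B : E → E [⋀^Fin 2]→L[ℝ] ℝ} {x : E} (hB : DifferentiableAt ℝ B x)
    (hclosed : extDeriv B x = 0) (a b c : E) :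
    fderiv ℝ (fun y => bilin (B y)) x a b c - fderiv ℝ (fun y => bilin (B y)) x b a c
      + fderiv ℝ (fun y => bilin (B y)) x c a b = 0 := by
  have h : fderiv ℝ (fun y => bilin (B y)) x = bilin.comp (fderiv ℝ B x) :=
    fderiv_clm_comp_left (V := E [⋀^Fin 2]→L[ℝ] ℝ) (W := E →L[ℝ] E →L[ℝ] ℝ) bilin hB
  have h2 := extDeriv_twoForm B x a b c
  rw [hclosed] at h2
  rw [h]
  exact h2.symm

lemma fderiv_bilin_swap {B : E → E [⋀^Fin 2]→L[ℝ] ℝ} {x : E} (hB : DifferentiableAt ℝ B x)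
    (a b c : E) :
    fderiv ℝ (fun y => bilin (B y)) x a c b = - fderiv ℝ (fun y => bilin (B y)) x a b c := by
  have h : fderiv ℝ (fun y => bilin (B y)) x = bilin.comp (fderiv ℝ B x) :=
    fderiv_clm_comp_left (V := E [⋀^Fin 2]→L[ℝ] ℝ) (W := E →L[ℝ] E →L[ℝ] ℝ) bilin hB
  rw [h]
  exact bilin_swap _ _ _

lemma contDiff_bilin {B : E → E [⋀^Fin 2]→L[ℝ] ℝ} (hB : ContDiff ℝ ∞ B) :
    ContDiff ℝ ∞ (fun y => bilin (B y)) :=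
  contDiff_clm_comp_left (V := E [⋀^Fin 2]→L[ℝ] ℝ) (W := E →L[ℝ] E →L[ℝ] ℝ) bilin hB

end Forms

/-! ### The magnetic potential -/

section Potential

variable {n : ℕ} {B : Space n → Space n [⋀^Fin 2]→L[ℝ] ℝ}

lemma potential_eq (B : Space n → Space n [⋀^Fin 2]→L[ℝ] ℝ) (x : Space n) :
    potential B x = ∫ u in (0 : ℝ)..1, u • bilin (B (u • x)) x := by
  unfold potential
  congr 1
  ext u v
  simp only [_root_.smul_apply, bilin_apply]
  congr 1
  simp only [ContinuousAlternatingMap.toContinuousLinearMap_apply]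
  congr 1
  ext i; fin_cases i <;> simp

lemma contDiff_radial_integrand {b : Space n → Space n →L[ℝ] Space n →L[ℝ] ℝ}
    (hb : ContDiff ℝ ∞ b) : ContDiff ℝ ∞ fun p : Space n × ℝ => p.2 • b (p.2 • p.1) p.1 :=
  contDiff_snd.smul ((hb.comp (contDiff_snd.smul contDiff_fst)).clm_apply contDiff_fst)

lemma contDiff_potential (hB : ContDiff ℝ ∞ B) : ContDiff ℝ ∞ (potential B) := by
  have := contDiff_parametric_integral (contDiff_radial_integrand (contDiff_bilin hB)) 0 1
  convert this using 1
  ext1 x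
  exact potential_eq B x

/-- The Poincaré lemma: a closed 2-form is the exterior derivative of its potential. -/
lemma fderiv_potential_sub (hB : ContDiff ℝ ∞ B) (hclosed : ∀ x, extDeriv B x = 0)
    (x v w : Space n) :
    fderiv ℝ (potential B) x v w - fderiv ℝ (potential B) x w v = bilin (B x) v w := by
  have hb := contDiff_bilin hB
  have hpot : potential B = fun x => ∫ u in (0 : ℝ)..1, u • bilin (B (u • x)) x :=
    funext (potential_eq B)
  have hbianchi := fun y : Space n =>
    fderiv_bilin_of_closed (hB.differentiable (by simp) y) (hclosed y)
  have hanti := fun y : Space n => fderiv_bilin_swap (hB.differentiable (by simp) y)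
  have hswap := fun y : Space n => bilin_swap (B y)
  -- replace the field of 2-forms by a field `b` of bilinear forms
  change _ = (fun y => bilin (B y)) x v w
  change ∀ y : Space n, ∀ v w : Space n, (fun y => bilin (B y)) y w v
    = -(fun y => bilin (B y)) y v w at hswap
  change potential B = fun x => ∫ u in (0 : ℝ)..1, u • (fun y => bilin (B y)) (u • x) x at hpot
  generalize (fun y => bilin (B y)) = b at *
  have hG := contDiff_radial_integrand hb
  have hd := hasFDerivAt_parametric_integral (hG.of_le (by simp)) 0 1 x
  have hdiff : Differentiable ℝ b := hb.differentiable (by simp)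
  have hpart : ∀ u : ℝ, ∀ a c : Space n,
      (fderiv ℝ (fun p : Space n × ℝ => p.2 • b (p.2 • p.1) p.1) (x, u)).comp
        (ContinuousLinearMap.inl ℝ (Space n) ℝ) a c
      = u ^ 2 * fderiv ℝ b (u • x) a x c + u * b (u • x) a c := by
    intro u a c
    have h1 : HasFDerivAt (fun p : Space n × ℝ => p.2 • b (p.2 • p.1) p.1)
      (fderiv ℝ (fun p : Space n × ℝ => p.2 • b (p.2 • p.1) p.1) (x, u)) (x, u) :=
      (hG.differentiable (by simp) _).hasFDerivAt
    have h2 := HasFDerivAt.comp (f := fun e : Space n => (e, u)) x h1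
      (hasFDerivAt_prodMk_left x u)
    have h3 := hasFDerivAt_radial (V := Space n →L[ℝ] ℝ) (hdiff (u • x))
    have h5 := h2.unique h3
    rw [h5]
    simp only [_root_.add_apply, _root_.smul_apply, ContinuousLinearMap.flip_apply,
      ContinuousLinearMap.comp_apply, ContinuousLinearMap.id_apply, map_smul, smul_eq_mul]
    ring
  have hcG : Continuous fun u : ℝ =>
      (fderiv ℝ (fun p : Space n × ℝ => p.2 • b (p.2 • p.1) p.1) (x, u)).comp
        (ContinuousLinearMap.inl ℝ (Space n) ℝ) :=
    ((hG.continuous_fderiv (by simp)).comp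
      (by fun_prop : Continuous fun u : ℝ => (x, u))).clm_comp continuous_const
  have hcont : ∀ a c : Space n, Continuous fun u : ℝ =>
      u ^ 2 * fderiv ℝ b (u • x) a x c + u * b (u • x) a c := by
    intro a c
    simp only [← hpart]
    exact (hcG.clm_apply continuous_const).clm_apply continuous_const
  have happ : ∀ a c : Space n, fderiv ℝ (potential B) x a c
      = ∫ u in (0 : ℝ)..1, (u ^ 2 * fderiv ℝ b (u • x) a x c + u * b (u • x) a c) := by
    intro a c
    rw [hpot, hd.fderiv, ContinuousLinearMap.intervalIntegral_apply (hcG.intervalIntegrable _ _),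
      ContinuousLinearMap.intervalIntegral_apply]
    · simp only [hpart]
    · exact (hcG.clm_apply continuous_const).intervalIntegrable _ _
  rw [happ, happ, ← intervalIntegral.integral_sub ((hcont v w).intervalIntegrable _ _)
    ((hcont w v).intervalIntegrable _ _)]
  -- by the Bianchi identity the integrand is the derivative of `u² b(u x)(v, w)`
  have hderiv : ∀ u ∈ Set.uIcc (0 : ℝ) 1, HasDerivAt (fun u : ℝ => u ^ 2 * b (u • x) v w)
      (u ^ 2 * fderiv ℝ b (u • x) v x w + u * b (u • x) v w -
        (u ^ 2 * fderiv ℝ b (u • x) w x v + u * b (u • x) w v)) u := by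
    intro u _
    have h1 : HasDerivAt (fun u : ℝ => b (u • x)) (fderiv ℝ b (u • x) x) u :=
      hasDerivAt_comp_ray (V := Space n →L[ℝ] Space n →L[ℝ] ℝ) (hdiff (u • x))
    have h2 : HasDerivAt (fun u : ℝ => b (u • x) v w) (fderiv ℝ b (u • x) x v w) u := by
      simpa using (h1.clm_apply (hasDerivAt_const u v)).clm_apply (hasDerivAt_const u w)
    refine ((hasDerivAt_pow 2 u).mul h2).congr_deriv ?_
    have hc := hbianchi (u • x) v x w
    rw [hanti (u • x) w x v] at hc
    rw [hswap (u • x) v w]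
    simp only [Nat.cast_ofNat, Nat.reduceSub, pow_one]
    linear_combination (-u ^ 2) * hc
  rw [intervalIntegral.integral_eq_sub_of_hasDerivAt hderiv
    (((hcont v w).sub (hcont w v)).intervalIntegrable _ _)]
  simp

end Potential

/-! ### Restriction of 1-forms to the sphere -/

section Restriction

variable {n : ℕ}

lemma hasMFDerivAt_chartSymm (p : Sph n) (y : EuclideanSpace ℝ (Fin n)) :
    HasMFDerivAt 𝓘(ℝ, EuclideanSpace ℝ (Fin n)) (𝓡 n)
      (chartAt (EuclideanSpace ℝ (Fin n)) p).symm y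
      (mfderiv 𝓘(ℝ, EuclideanSpace ℝ (Fin n)) (𝓡 n)
        (chartAt (EuclideanSpace ℝ (Fin n)) p).symm y) :=
  ((contMDiffOn_chart_symm (I := 𝓡 n) (n := 1) (x := p)).contMDiffAt
    (by rw [chartAt_target]; exact Filter.univ_mem)).mdifferentiableAt one_ne_zero |>.hasMFDerivAt

lemma hasMFDerivAt_chart (p : Sph n) {σ : Sph n} (hσ : σ ≠ -p) :
    HasMFDerivAt (𝓡 n) 𝓘(ℝ, EuclideanSpace ℝ (Fin n))
      (chartAt (EuclideanSpace ℝ (Fin n)) p) σ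
      (mfderiv (𝓡 n) 𝓘(ℝ, EuclideanSpace ℝ (Fin n))
        (chartAt (EuclideanSpace ℝ (Fin n)) p) σ) :=
  ((contMDiffOn_chart (I := 𝓡 n) (n := 1) (x := p)).contMDiffAt
    ((chartAt (EuclideanSpace ℝ (Fin n)) p).open_source.mem_nhds
      (by rw [chartAt_source]; exact hσ))).mdifferentiableAt one_ne_zero |>.hasMFDerivAt

lemma hasFDerivAt_chartParam (p : Sph n) (y : EuclideanSpace ℝ (Fin n)) :
    HasFDerivAt (chartParam p) (fderiv ℝ (chartParam p) y) y :=
  ((contDiff_chartParam p).differentiable (by simp) y).hasFDerivAt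

lemma tangentIncl_comp_mfderiv_chartSymm (p : Sph n) (y : EuclideanSpace ℝ (Fin n)) :
    (tangentIncl ((chartAt (EuclideanSpace ℝ (Fin n)) p).symm y)).comp
      (mfderiv 𝓘(ℝ, EuclideanSpace ℝ (Fin n)) (𝓡 n)
        (chartAt (EuclideanSpace ℝ (Fin n)) p).symm y) = fderiv ℝ (chartParam p) y := by
  have h1 := (hasMFDerivAt_coe ((chartAt (EuclideanSpace ℝ (Fin n)) p).symm y)).comp y
    (hasMFDerivAt_chartSymm p y)
  have h2 : HasMFDerivAt 𝓘(ℝ, EuclideanSpace ℝ (Fin n)) 𝓘(ℝ, Space n) (chartParam p) y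
    (fderiv ℝ (chartParam p) y) := (hasFDerivAt_chartParam p y).hasMFDerivAt
  exact hasMFDerivAt_unique h1 h2

lemma fderiv_chartParam_comp_mfderiv_chart (p : Sph n) {σ : Sph n} (hσ : σ ≠ -p) :
    (fderiv ℝ (chartParam p) (chartAt (EuclideanSpace ℝ (Fin n)) p σ)).comp
      (mfderiv (𝓡 n) 𝓘(ℝ, EuclideanSpace ℝ (Fin n))
        (chartAt (EuclideanSpace ℝ (Fin n)) p) σ) = tangentIncl σ := by
  have h1 := (hasFDerivAt_chartParam p (chartAt (EuclideanSpace ℝ (Fin n)) p σ)).hasMFDerivAt.comp σ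
    (hasMFDerivAt_chart p hσ)
  have h2 : HasMFDerivAt (𝓡 n) 𝓘(ℝ, Space n)
      (chartParam p ∘ chartAt (EuclideanSpace ℝ (Fin n)) p) σ (tangentIncl σ) := by
    refine (hasMFDerivAt_coe σ).congr_of_eventuallyEq ?_
    filter_upwards [isOpen_compl_singleton.mem_nhds hσ] with τ hτ
    exact chartParam_chartAt p hτ
  exact hasMFDerivAt_unique h1 h2

/-- The image of a coordinate vector is tangent to the sphere. -/
lemma inner_fderiv_chartParam (p : Sph n) (y v : EuclideanSpace ℝ (Fin n)) :
    inner ℝ (chartParam p y) (fderiv ℝ (chartParam p) y v) = 0 := by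
  have h := congrArg (fun L : EuclideanSpace ℝ (Fin n) →L[ℝ] Space n => L v)
    (tangentIncl_comp_mfderiv_chartSymm p y)
  have h' : tangentIncl ((chartAt (EuclideanSpace ℝ (Fin n)) p).symm y)
      (mfderiv 𝓘(ℝ, EuclideanSpace ℝ (Fin n)) (𝓡 n)
        (chartAt (EuclideanSpace ℝ (Fin n)) p).symm y v) = fderiv ℝ (chartParam p) y v := h
  rw [← h']
  exact inner_self_tangentIncl _ _

/-- The pull-back of a covector field on the ambient space along the inverse of a chart. -/
def chartPullback (α : Space n → Space n →L[ℝ] ℝ) (p : Sph n) (y : EuclideanSpace ℝ (Fin n)) :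
    EuclideanSpace ℝ (Fin n) →L[ℝ] ℝ :=
  (α (chartParam p y)).comp (fderiv ℝ (chartParam p) y)

lemma contDiff_chartPullback {α : Space n → Space n →L[ℝ] ℝ} (hα : ContDiff ℝ ∞ α) (p : Sph n) :
    ContDiff ℝ ∞ (chartPullback α p) :=
  (hα.comp (contDiff_chartParam p)).clm_comp
    ((contDiff_chartParam p).fderiv_right (m := ∞) (by simp))

lemma extDeriv_chartPullback {α : Space n → Space n →L[ℝ] ℝ} (hα : ContDiff ℝ ∞ α) (p : Sph n)
    (y v w : EuclideanSpace ℝ (Fin n)) :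
    extDeriv (oneForm (chartPullback α p)) y ![v, w] =
      fderiv ℝ α (chartParam p y) (fderiv ℝ (chartParam p) y v) (fderiv ℝ (chartParam p) y w) -
      fderiv ℝ α (chartParam p y) (fderiv ℝ (chartParam p) y w) (fderiv ℝ (chartParam p) y v) := by
  have hd := hα.differentiable (by simp) (chartParam p y)
  have h := extDeriv_pullback (𝕜 := ℝ) (x := y) (r := ∞) (f := chartParam p)
    (differentiableAt_oneForm hd) (contDiff_chartParam p).contDiffAt
    (by
      rw [minSmoothness_of_isRCLikeNormedField]
      exact WithTop.coe_le_coe.2 (le_top : (2 : ℕ∞) ≤ ⊤))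
  have h2 : (fun x => (oneForm α (chartParam p x)).compContinuousLinearMap
      (fderiv ℝ (chartParam p) x)) = oneForm (chartPullback α p) := by
    ext x m
    rfl
  rw [h2] at h
  rw [h, ← extDeriv_oneForm hd, ContinuousAlternatingMap.compContinuousLinearMap_apply]
  congr 1
  ext i : 1
  fin_cases i <;> rfl

lemma chartRep_eq (α : Space n → Space n →L[ℝ] ℝ) (p : Sph n) :
    chartRep (fun σ => (α σ).comp (tangentIncl σ)) p = oneForm (chartPullback α p) := by
  ext y v
  have h := congrArg (fun L : EuclideanSpace ℝ (Fin n) →L[ℝ] Space n =>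
    α (chartParam p y) (L (v 0))) (tangentIncl_comp_mfderiv_chartSymm p y)
  exact h

/-- The exterior derivative on the sphere of the restriction of an ambient 1-form is the
restriction of its exterior derivative. -/
lemma sphExtDeriv_restrict {α : Space n → Space n →L[ℝ] ℝ} (hα : ContDiff ℝ ∞ α) (σ : Sph n)
    (v w : EuclideanSpace ℝ (Fin n)) :
    sphExtDeriv (fun σ => (α σ).comp (tangentIncl σ)) σ ![v, w] =
      fderiv ℝ α σ (tangentIncl σ v) (tangentIncl σ w) -
      fderiv ℝ α σ (tangentIncl σ w) (tangentIncl σ v) := by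
  have h := extDeriv_chartPullback hα σ (chartAt (EuclideanSpace ℝ (Fin n)) σ σ) v w
  have h0 : fderiv ℝ (chartParam σ) 0 = (modelIsometry σ).toContinuousLinearMap :=
    (hasFDerivAt_chartParam_zero σ).fderiv
  rw [chartParam_chartAt σ (self_ne_neg σ), chartAt_self, h0] at h
  rw [tangentIncl_apply, tangentIncl_apply]
  refine Eq.trans ?_ h
  rw [← chartRep_eq, ← chartAt_self σ]
  rfl

end Restriction

/-! ### Closed 1-forms on the sphere are exact -/

section Exactness

variable {n : ℕ}

/-- The target of each chart is the whole model space, so that a closed 1-form has a primitive in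
each chart. -/
lemma exists_primitive_chart {α : Space n → Space n →L[ℝ] ℝ} (hα : ContDiff ℝ ∞ α)
    (hclosed : ∀ (σ : Sph n) (v w : Space n), inner ℝ (σ : Space n) v = 0 →
      inner ℝ (σ : Space n) w = 0 → fderiv ℝ α σ v w = fderiv ℝ α σ w v) (p : Sph n) :
    ∃ g : EuclideanSpace ℝ (Fin n) → ℝ, ContDiff ℝ ∞ g ∧
      ∀ y, HasFDerivAt g (chartPullback α p y) y := by
  have hsm := contDiff_chartPullback hα p
  obtain ⟨g, hg⟩ := convex_univ.exists_forall_hasFDerivAt_of_fderiv_symmetric isOpen_univ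
    (hsm.differentiable (by simp)).differentiableOn (fun y _ v w => by
      rw [← sub_eq_zero, ← extDeriv_oneForm (hsm.differentiable (by simp) y),
        extDeriv_chartPullback hα, sub_eq_zero]
      exact hclosed ((chartAt (EuclideanSpace ℝ (Fin n)) p).symm y) _ _
        (inner_fderiv_chartParam p y v) (inner_fderiv_chartParam p y w))
  refine ⟨g, ?_, fun y => hg y trivial⟩
  rw [contDiff_infty_iff_fderiv]
  refine ⟨fun y => (hg y trivial).differentiableAt, ?_⟩
  convert hsm using 1
  ext1 y
  exact (hg y trivial).fderiv

/-- A closed 1-form on a sphere of dimension at least two is exact. -/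
theorem exists_primitive {α : Space n → Space n →L[ℝ] ℝ} (hn : 2 ≤ n) (hα : ContDiff ℝ ∞ α)
    (hclosed : ∀ (σ : Sph n) (v w : Space n), inner ℝ (σ : Space n) v = 0 →
      inner ℝ (σ : Space n) w = 0 → fderiv ℝ α σ v w = fderiv ℝ α σ w v) :
    ∃ f : Sph n → ℝ, ContMDiff (𝓡 n) 𝓘(ℝ, ℝ) ∞ f ∧
      ∀ σ, HasMFDerivAt (𝓡 n) 𝓘(ℝ, ℝ) f σ ((α σ).comp (tangentIncl σ)) := by
  choose g hgs hg using exists_primitive_chart hα hclosed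
  set G : Sph n → Sph n → ℝ := fun p σ => g p (chartAt (EuclideanSpace ℝ (Fin n)) p σ) with hG
  have hGs : ∀ p σ, σ ≠ -p → ContMDiffAt (𝓡 n) 𝓘(ℝ, ℝ) ∞ (G p) σ := by
    intro p σ hσ
    refine (hgs p).contMDiff.contMDiffAt.comp σ ?_
    exact (contMDiffOn_chart (I := 𝓡 n) (n := ∞) (x := p)).contMDiffAt
      ((chartAt (EuclideanSpace ℝ (Fin n)) p).open_source.mem_nhds
        (by rw [chartAt_source]; exact hσ))
  have hGd : ∀ p σ, σ ≠ -p →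
      HasMFDerivAt (𝓡 n) 𝓘(ℝ, ℝ) (G p) σ ((α σ).comp (tangentIncl σ)) := by
    intro p σ hσ
    have h := (hg p (chartAt (EuclideanSpace ℝ (Fin n)) p σ)).hasMFDerivAt.comp σ
      (hasMFDerivAt_chart p hσ)
    rw [← fderiv_chartParam_comp_mfderiv_chart p hσ]
    unfold chartPullback at h
    rw [chartParam_chartAt p hσ] at h
    exact h
  have : Nontrivial (Space n) := inferInstance
  obtain ⟨p⟩ : Nonempty (Sph n) := (NormedSpace.sphere_nonempty.2 zero_le_one).to_subtype
  -- on the overlap of the two charts, which is connected as the dimension is at least two, the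
  -- primitives differ by a constant
  obtain ⟨c, hc⟩ : ∃ c, ∀ σ, σ ≠ p → σ ≠ -p → G (-p) σ = G p σ + c := by
    set h : EuclideanSpace ℝ (Fin n) → ℝ := fun y =>
      G (-p) ((chartAt (EuclideanSpace ℝ (Fin n)) p).symm y) - g p y with hh
    have hsymm : ∀ y ≠ 0, (chartAt (EuclideanSpace ℝ (Fin n)) p).symm y ≠ p := by
      intro y hy hp
      apply hy
      apply chartParam_injective p
      rw [← chartAt_self p, chartParam_chartAt p (self_ne_neg p)]
      exact congrArg _ hp
    have hh0 : ∀ y ≠ 0, HasFDerivAt h (0 : EuclideanSpace ℝ (Fin n) →L[ℝ] ℝ) y := by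
      intro y hy
      have h1 := (hGd (-p) _ (by rw [neg_neg]; exact hsymm y hy)).comp y
        (hasMFDerivAt_chartSymm p y)
      have h2 : ((α ((chartAt (EuclideanSpace ℝ (Fin n)) p).symm y : Sph n)).comp
          (tangentIncl ((chartAt (EuclideanSpace ℝ (Fin n)) p).symm y))).comp
        (mfderiv 𝓘(ℝ, EuclideanSpace ℝ (Fin n)) (𝓡 n)
        (chartAt (EuclideanSpace ℝ (Fin n)) p).symm y) = chartPullback α p y := by
        rw [ContinuousLinearMap.comp_assoc, tangentIncl_comp_mfderiv_chartSymm]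
        rfl
      have h3 : HasFDerivAt (G (-p) ∘ (chartAt (EuclideanSpace ℝ (Fin n)) p).symm)
          (chartPullback α p y) y := by
        have h1' : HasMFDerivAt 𝓘(ℝ, EuclideanSpace ℝ (Fin n)) 𝓘(ℝ, ℝ)
            (G (-p) ∘ (chartAt (EuclideanSpace ℝ (Fin n)) p).symm) y (chartPullback α p y) := by
          rw [← h2]
          exact h1
        exact h1'.hasFDerivAt
      have h4 := h3.sub (hg p y)
      rw [sub_self] at h4
      exact h4
    have hpre : IsPreconnected ({0}ᶜ : Set (EuclideanSpace ℝ (Fin n))) := by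
      refine (isConnected_compl_singleton_of_one_lt_rank ?_ 0).isPreconnected
      rw [← Module.finrank_eq_rank, finrank_euclideanSpace_fin]
      exact_mod_cast hn
    obtain ⟨c, hc⟩ := isOpen_compl_singleton.exists_is_const_of_fderiv_eq_zero (𝕜 := ℝ) hpre
      (f := h)
      (fun y hy => (hh0 y hy).differentiableAt.differentiableWithinAt)
      (fun y hy => (hh0 y hy).fderiv)
    refine ⟨c, fun σ h1 h2 => ?_⟩
    have hy : chartAt (EuclideanSpace ℝ (Fin n)) p σ ≠ 0 := by
      intro h0
      apply h1
      have := chartParam_chartAt p h2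
      rw [h0, ← chartAt_self p, chartParam_chartAt p (self_ne_neg p)] at this
      exact (Subtype.ext this).symm
    have := hc _ hy
    simp only [hh] at this
    rw [OpenPartialHomeomorph.left_inv _ (by rw [chartAt_source]; exact h2)] at this
    simp only [hG] at this ⊢
    linarith
  classical
  -- glue the two primitives
  set f : Sph n → ℝ := fun σ => if σ = -p then G (-p) (-p) - c else G p σ with hf
  have hf1 : ∀ σ, σ ≠ -p → f =ᶠ[𝓝 σ] G p := by
    intro σ hσ
    filter_upwards [isOpen_compl_singleton.mem_nhds hσ] with τ hτ
    exact if_neg hτ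
  have hf2 : ∀ σ, σ ≠ p → f =ᶠ[𝓝 σ] fun τ => G (-p) τ - c := by
    intro σ hσ
    filter_upwards [isOpen_compl_singleton.mem_nhds hσ] with τ hτ
    by_cases h : τ = -p
    · simp [hf, h]
    · simp only [hf, h, if_false, hc τ hτ h]
      ring
  refine ⟨f, fun σ => ?_, fun σ => ?_⟩
  · by_cases h : σ = -p
    · have hσ : σ ≠ p := by rw [h]; exact (self_ne_neg p).symm
      refine ContMDiffAt.congr_of_eventuallyEq ?_ (hf2 σ hσ)
      exact (hGs (-p) σ (by rwa [neg_neg])).sub contMDiffAt_const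
    · exact (hGs p σ h).congr_of_eventuallyEq (hf1 σ h)
  · by_cases h : σ = -p
    · have hσ : σ ≠ p := by rw [h]; exact (self_ne_neg p).symm
      refine HasMFDerivAt.congr_of_eventuallyEq ?_ (hf2 σ hσ)
      have := (hGd (-p) σ (by rwa [neg_neg])).sub (hasMFDerivAt_const c σ)
      exact this.congr_mfderiv (sub_zero (G := TangentSpace (𝓡 n) σ →L[ℝ] ℝ) _)
    · exact (hGd p σ h).congr_of_eventuallyEq (hf1 σ h)

end Exactness

/-! ### The magnetic tensor on the sphere of radius `r` -/

section Scaling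

variable {n : ℕ} {B : Space n → Space n [⋀^Fin 2]→L[ℝ] ℝ}

/-- The pull-back of the magnetic potential along the dilation `x ↦ r x` of the ambient space. -/
def scaledPotential (B : Space n → Space n [⋀^Fin 2]→L[ℝ] ℝ) (r : ℝ) (x : Space n) :
    Space n →L[ℝ] ℝ :=
  r • potential B (r • x)

lemma contDiff_scaledPotential (hB : ContDiff ℝ ∞ B) (r : ℝ) :
    ContDiff ℝ ∞ (scaledPotential B r) :=
  ((contDiff_potential hB).comp (contDiff_const_smul r)).const_smul r

lemma fderiv_scaledPotential_sub (hB : ContDiff ℝ ∞ B) (hclosed : ∀ x, extDeriv B x = 0) (r : ℝ)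
    (x v w : Space n) :
    fderiv ℝ (scaledPotential B r) x v w - fderiv ℝ (scaledPotential B r) x w v =
      r ^ 2 * B (r • x) ![v, w] := by
  have h := hasFDerivAt_comp_dilation (V := Space n →L[ℝ] ℝ) (u := r) (x := x)
    ((contDiff_potential hB).differentiable (by simp) (r • x))
  have h2 : fderiv ℝ (scaledPotential B r) x = r • ((fderiv ℝ (potential B) (r • x)).comp
      (r • ContinuousLinearMap.id ℝ (Space n))) :=
    (HasFDerivAt.const_smul (F := Space n →L[ℝ] ℝ) h r).fderiv
  rw [h2, ← bilin_apply, ← fderiv_potential_sub hB hclosed]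
  simp only [_root_.smul_apply, ContinuousLinearMap.comp_apply, ContinuousLinearMap.id_apply,
    map_smul, smul_eq_mul]
  ring

lemma mvfderiv_dilate (r : ℝ) (σ : Sph n) :
    mvfderiv (𝓡 n) (dilate r) σ = r • tangentIncl σ := by
  have h := mvfderiv_comp_coe σ ((hasFDerivAt_id (𝕜 := ℝ) (σ : Space n)).const_smul r)
  exact h

lemma sphPotential_eq (B : Space n → Space n [⋀^Fin 2]→L[ℝ] ℝ) (r : ℝ) (σ : Sph n) :
    sphPotential B r σ = (scaledPotential B r σ).comp (tangentIncl σ) := by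
  rw [sphPotential, mvfderiv_dilate]
  ext v
  simp [scaledPotential, dilate]

/-- The magnetic tensor on the sphere is the restriction of the field, up to the factor `r²`. -/
lemma sphField_apply (hB : ContDiff ℝ ∞ B) (hclosed : ∀ x, extDeriv B x = 0) (r : ℝ) (σ : Sph n)
    (v w : EuclideanSpace ℝ (Fin n)) :
    sphField B r σ ![v, w] = r ^ 2 * B (dilate r σ) ![tangentIncl σ v, tangentIncl σ w] := by
  have h : sphPotential B r = fun σ : Sph n => (scaledPotential B r σ).comp (tangentIncl σ) :=
    funext (sphPotential_eq B r)
  rw [sphField, h, sphExtDeriv_restrict (contDiff_scaledPotential hB r),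
    fderiv_scaledPotential_sub hB hclosed]
  rfl

end Scaling

/-! ### Hodge duals of 2-forms in components -/

section LeviCivita

lemma twoForm_swap {E : Type} [NormedAddCommGroup E] [NormedSpace ℝ E] (β : E [⋀^Fin 2]→L[ℝ] ℝ)
    (v w : E) : β ![w, v] = -β ![v, w] := by
  rw [← bilin_apply, ← bilin_apply, bilin_swap]

lemma leviCivita_eq_zero {N : ℕ} {f : Fin N → Fin N} (hf : ¬ Function.Injective f) :
    leviCivita f = 0 := by
  simp only [Function.Injective, not_forall] at hf
  obtain ⟨i, j, hij, hne⟩ := hf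
  refine Matrix.det_zero_of_row_eq hne ?_
  ext k
  simp [hij]

lemma leviCivita_ne_zero {N : ℕ} {f : Fin N → Fin N} (hf : Function.Injective f) :
    leviCivita f ≠ 0 := by
  have hb := Finite.injective_iff_bijective.1 hf
  have h : (Matrix.of fun i j : Fin N => if f i = j then (1 : ℝ) else 0) =
      Equiv.Perm.permMatrix ℝ (Equiv.ofBijective f hb) := by
    ext i j
    simp [Equiv.Perm.permMatrix, PEquiv.toMatrix_apply, eq_comm]
  rw [leviCivita, h, Matrix.det_permutation]
  exact_mod_cast Units.ne_zero _

lemma leviCivita_comp {N : ℕ} (f : Fin N → Fin N) (e : Equiv.Perm (Fin N)) :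
    leviCivita (f ∘ e) = (Equiv.Perm.sign e : ℤ) * leviCivita f :=
  Matrix.det_permute e (Matrix.of fun i j : Fin N => if f i = j then (1 : ℝ) else 0)

lemma leviCivita_snoc_swap {k : ℕ} (l : Fin k → Fin (k + 2)) (a b : Fin (k + 2)) :
    leviCivita (Fin.snoc (Fin.snoc l b) a : Fin (k + 2) → Fin (k + 2)) =
      -leviCivita (Fin.snoc (Fin.snoc l a) b : Fin (k + 2) → Fin (k + 2)) := by
  have h : (Fin.snoc (Fin.snoc l b) a : Fin (k + 2) → Fin (k + 2)) =
      (Fin.snoc (Fin.snoc l a) b : Fin (k + 2) → Fin (k + 2)) ∘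
        Equiv.swap (Fin.last (k + 1)) (Fin.last k).castSucc := by
    ext i
    congr 1
    refine Fin.lastCases ?_ (fun i => Fin.lastCases ?_ (fun i => ?_) i) i
    · simp
    · simp
    · have h1 : i.castSucc.castSucc ≠ Fin.last (k + 1) := (Fin.castSucc_lt_last _).ne
      have h2 : i.castSucc.castSucc ≠ (Fin.last k).castSucc := fun h =>
        (Fin.castSucc_lt_last i).ne (Fin.castSucc_injective _ h)
      simp [Equiv.swap_apply_of_ne_of_ne h1 h2]
  rw [h, leviCivita_comp, Equiv.Perm.sign_swap (Fin.castSucc_lt_last _).ne']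
  simp

lemma snoc_injective_iff {k : ℕ} {X : Type*} {l : Fin k → X} {a : X} :
    Function.Injective (Fin.snoc l a : Fin (k + 1) → X) ↔
      Function.Injective l ∧ ∀ t, l t ≠ a := by
  rw [Fin.snoc_injective_iff]
  simp

/-- The Levi-Civita symbol singles out the two indices complementary to `l`. -/
lemma sum_leviCivita {k : ℕ} {β : Matrix (Fin (k + 2)) (Fin (k + 2)) ℝ}
    (hβ : ∀ i j, β j i = -β i j) {l : Fin k → Fin (k + 2)} {a b : Fin (k + 2)}
    (hl : Function.Injective (Fin.snoc (Fin.snoc l a) b : Fin (k + 2) → Fin (k + 2))) :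
    ∑ i, ∑ j, leviCivita (Fin.snoc (Fin.snoc l i) j : Fin (k + 2) → Fin (k + 2)) * β i j =
      2 * leviCivita (Fin.snoc (Fin.snoc l a) b : Fin (k + 2) → Fin (k + 2)) * β a b := by
  have hsurj := Finite.injective_iff_surjective.1 hl
  have hcases : ∀ i, (∃ t, l t = i) ∨ i = a ∨ i = b := by
    intro i
    obtain ⟨t, rfl⟩ := hsurj i
    refine Fin.lastCases ?_ (fun t => Fin.lastCases ?_ (fun t => ?_) t) t <;> simp
  have hinj : ∀ i j, leviCivita (Fin.snoc (Fin.snoc l i) j : Fin (k + 2) → Fin (k + 2)) ≠ 0 →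
      (i = a ∨ i = b) ∧ (j = a ∨ j = b) ∧ i ≠ j := by
    intro i j h
    have h' : Function.Injective (Fin.snoc (Fin.snoc l i) j : Fin (k + 2) → Fin (k + 2)) := by
      by_contra hc
      exact h (leviCivita_eq_zero hc)
    rw [snoc_injective_iff, snoc_injective_iff] at h'
    obtain ⟨⟨_, h2⟩, h3⟩ := h'
    refine ⟨(hcases i).resolve_left fun ⟨t, ht⟩ => h2 t ht,
      (hcases j).resolve_left fun ⟨t, ht⟩ => h3 t.castSucc (by simpa using ht), ?_⟩
    have := h3 (Fin.last k)
    simpa using this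
  have hab : a ≠ b := by
    have := (snoc_injective_iff.1 hl).2 (Fin.last k)
    simpa using this
  have hz : ∀ i j, ¬ ((i = a ∨ i = b) ∧ (j = a ∨ j = b) ∧ i ≠ j) →
      leviCivita (Fin.snoc (Fin.snoc l i) j : Fin (k + 2) → Fin (k + 2)) * β i j = 0 := by
    intro i j h
    by_contra hc
    exact h (hinj i j (left_ne_zero_of_mul hc))
  rw [Fintype.sum_eq_add a b hab, Fintype.sum_eq_single b, Fintype.sum_eq_single a,
    leviCivita_snoc_swap l a b, hβ a b]
  · ring
  · intro j hj
    apply hz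
    rintro ⟨-, h2, h3⟩
    rcases h2 with h2 | h2
    · exact hj h2
    · exact h3 h2.symm
  · intro j hj
    apply hz
    rintro ⟨-, h2, h3⟩
    rcases h2 with h2 | h2
    · exact h3 h2.symm
    · exact hj h2
  · rintro i ⟨h1, h2⟩
    refine Finset.sum_eq_zero fun j _ => hz _ _ ?_
    rintro ⟨h3, -⟩
    tauto

lemma hodgeDual_eq {k : ℕ} (s : ℝ) (g β : Matrix (Fin (k + 2)) (Fin (k + 2)) ℝ)
    (l : Fin k → Fin (k + 2)) :
    hodgeDual s g β l = (1 / 2) * (s * (Real.sqrt g.det)⁻¹ *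
      ∑ i, ∑ j, leviCivita (Fin.snoc (Fin.snoc l i) j : Fin (k + 2) → Fin (k + 2)) * β i j) := by
  rw [hodgeDual]
  congr 1
  simp only [Finset.mul_sum, mul_assoc]

/-- A component of a 2-form can be read off the component of its Hodge dual with the
complementary indices. -/
lemma eq_zero_of_hodgeDual_eq_zero {k : ℕ} {s : ℝ} {g β : Matrix (Fin (k + 2)) (Fin (k + 2)) ℝ}
    (hs : s ≠ 0) (hg : 0 < g.det) (hβ : ∀ i j, β j i = -β i j) {l : Fin k → Fin (k + 2)}
    {a b : Fin (k + 2)}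
    (hl : Function.Injective (Fin.snoc (Fin.snoc l a) b : Fin (k + 2) → Fin (k + 2)))
    (h : hodgeDual s g β l = 0) : β a b = 0 := by
  rw [hodgeDual_eq, sum_leviCivita hβ hl] at h
  have h1 := (Real.sqrt_pos.2 hg).ne'
  have h2 := leviCivita_ne_zero hl
  simpa [hs, h1, h2] using h

/-- Only the components whose indices do not occur in `l` contribute to the Hodge dual. -/
lemma hodgeDual_eq_zero {k : ℕ} {s : ℝ} {g β : Matrix (Fin (k + 2)) (Fin (k + 2)) ℝ}
    {l : Fin k → Fin (k + 2)} (h : ∀ i j, (∀ t, l t ≠ i) → (∀ t, l t ≠ j) → β i j = 0) :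
    hodgeDual s g β l = 0 := by
  rw [hodgeDual_eq]
  have : ∑ i, ∑ j, leviCivita (Fin.snoc (Fin.snoc l i) j : Fin (k + 2) → Fin (k + 2)) * β i j
      = 0 := by
    refine Finset.sum_eq_zero fun i _ => Finset.sum_eq_zero fun j _ => ?_
    by_cases hinj : Function.Injective (Fin.snoc (Fin.snoc l i) j : Fin (k + 2) → Fin (k + 2))
    · rw [snoc_injective_iff, snoc_injective_iff] at hinj
      rw [h i j hinj.1.2 fun t => by simpa using hinj.2 t.castSucc, mul_zero]
    · rw [leviCivita_eq_zero hinj, zero_mul]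
  rw [this]
  simp

lemma exists_complementary {m : ℕ} {a b : Fin (m + 2)} (hab : a ≠ b) :
    ∃ l : Fin m → Fin (m + 2),
      Function.Injective (Fin.snoc (Fin.snoc l a) b : Fin (m + 2) → Fin (m + 2)) := by
  have hcard : (({a, b}ᶜ : Finset (Fin (m + 2)))).card = m := by
    rw [Finset.card_compl, Finset.card_pair hab]
    simp
  refine ⟨Finset.orderEmbOfFin _ hcard, ?_⟩
  have hmem : ∀ t, Finset.orderEmbOfFin _ hcard t ∈ ({a, b}ᶜ : Finset (Fin (m + 2))) :=
    Finset.orderEmbOfFin_mem _ hcard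
  rw [snoc_injective_iff, snoc_injective_iff]
  refine ⟨⟨(Finset.orderEmbOfFin _ hcard).injective, fun t ht => ?_⟩, fun t => ?_⟩
  · have := hmem t
    rw [ht] at this
    simp at this
  · refine Fin.lastCases (by simpa using hab) (fun t ht => ?_) t
    rw [Fin.snoc_castSucc] at ht
    have := hmem t
    rw [ht] at this
    simp at this

end LeviCivita

section Frame

variable {n : ℕ}

/-- The coordinate frame of the spherical coordinates is orthogonal. -/
lemma gram_sphericalFrame (r : ℝ) (σ : Sph n) :
    (Matrix.of fun j k => inner ℝ (sphericalFrame r σ j) (sphericalFrame r σ k) :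
      Matrix (Fin (n + 1)) (Fin (n + 1)) ℝ) =
      Matrix.diagonal (Fin.snoc (fun _ => r ^ 2) 1 : Fin (n + 1) → ℝ) := by
  have horth : ∀ μ, inner ℝ (σ : Space n) (tangentIncl σ (coordVec σ μ)) = 0 :=
    fun μ => inner_self_tangentIncl σ _
  have hgram : ∀ μ ν, inner ℝ (tangentIncl σ (coordVec σ μ)) (tangentIncl σ (coordVec σ ν)) =
      if μ = ν then (1 : ℝ) else 0 := by
    intro μ ν
    have := congrFun (congrFun (roundMetric_eq_one σ) μ) ν
    rw [Matrix.one_apply] at this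
    exact this
  ext j k
  rw [Matrix.of_apply, Matrix.diagonal_apply]
  refine Fin.lastCases ?_ (fun μ => ?_) j <;> refine Fin.lastCases ?_ (fun ν => ?_) k
  · simp [sphericalFrame]
  · simp [sphericalFrame, inner_smul_right, horth, (Fin.castSucc_lt_last ν).ne']
  · simp [sphericalFrame, inner_smul_left, real_inner_comm, horth, (Fin.castSucc_lt_last μ).ne]
  · simp only [sphericalFrame, Fin.snoc_castSucc, inner_smul_left, inner_smul_right, hgram,
      Fin.castSucc_inj, conj_trivial]
    split_ifs <;> ring

lemma det_gram_sphericalFrame (r : ℝ) (σ : Sph n) :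
    (Matrix.of fun j k => inner ℝ (sphericalFrame r σ j) (sphericalFrame r σ k) :
      Matrix (Fin (n + 1)) (Fin (n + 1)) ℝ).det = (r ^ 2) ^ n := by
  rw [gram_sphericalFrame, Matrix.det_diagonal, Fin.prod_univ_castSucc]
  simp

lemma orientationSign_ne_zero (σ : Sph n) : orientationSign σ ≠ 0 := by
  have h := det_gram_sphericalFrame 1 σ
  set F : Matrix (Fin (n + 1)) (Fin (n + 1)) ℝ :=
    Matrix.of fun j k : Fin (n + 1) => sphericalFrame 1 σ j k with hF
  have hmul : (Matrix.of fun j k => inner ℝ (sphericalFrame 1 σ j) (sphericalFrame 1 σ k) :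
      Matrix (Fin (n + 1)) (Fin (n + 1)) ℝ) = F * F.transpose := by
    ext j k
    simp [Matrix.mul_apply, hF, PiLp.inner_apply, mul_comm]
  rw [hmul, Matrix.det_mul, Matrix.det_transpose] at h
  have hne : F.det ≠ 0 := by
    intro h0
    rw [h0] at h
    simp at h
  rw [orientationSign, ← hF]
  rw [Ne, Real.sign_eq_zero_iff]
  exact hne

end Frame

section HodgeEquivalences

variable {m : ℕ} {B : Space (m + 2) → Space (m + 2) [⋀^Fin 2]→L[ℝ] ℝ}

lemma sphField_eq_zero_iff {n : ℕ} {B : Space n → Space n [⋀^Fin 2]→L[ℝ] ℝ} {r : ℝ} {σ : Sph n} :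
    sphField B r σ = 0 ↔ ∀ μ ν, sphField B r σ ![coordVec σ μ, coordVec σ ν] = 0 := by
  refine ⟨fun h μ ν => by rw [h]; rfl, fun h => ?_⟩
  set β : EuclideanSpace ℝ (Fin n) [⋀^Fin 2]→L[ℝ] ℝ := sphField B r σ with hβ
  have hb : bilin β = 0 := by
    apply ContinuousLinearMap.coe_injective
    refine (EuclideanSpace.basisFun (Fin n) ℝ).toBasis.ext fun μ => ?_
    apply ContinuousLinearMap.coe_injective
    refine (EuclideanSpace.basisFun (Fin n) ℝ).toBasis.ext fun ν => ?_
    simp only [OrthonormalBasis.coe_toBasis, EuclideanSpace.basisFun_apply]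
    exact (bilin_apply β _ _).trans (h μ ν)
  change β = 0
  ext v
  have h1 : v = ![v 0, v 1] := by
    ext1 i; fin_cases i <;> rfl
  rw [h1, ← bilin_apply, hb]
  rfl

/-- Each component of the magnetic tensor is, up to a nonzero factor, a component of its Hodge
dual. -/
lemma sphField_eq_zero_iff_sphHodge (r : ℝ) (σ : Sph (m + 2)) :
    sphField B r σ = 0 ↔ ∀ l : Fin m → Fin (m + 2), sphHodge B r σ l = 0 := by
  refine ⟨fun h l => hodgeDual_eq_zero fun i j _ _ => ?_, fun h => ?_⟩
  · rw [Matrix.of_apply, h]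
    rfl
  · have hanti : ∀ i j, sphField B r σ ![coordVec σ j, coordVec σ i] =
        -sphField B r σ ![coordVec σ i, coordVec σ j] := fun i j =>
      twoForm_swap (E := EuclideanSpace ℝ (Fin (m + 2))) (sphField B r σ) _ _
    rw [sphField_eq_zero_iff]
    intro a b
    by_cases hab : a = b
    · have := hanti a b
      rw [hab] at this ⊢
      linarith
    · obtain ⟨l, hl⟩ := exists_complementary hab
      have := eq_zero_of_hodgeDual_eq_zero (orientationSign_ne_zero σ)
        (by rw [roundMetric_eq_one]; simp) (fun i j => by
          simpa only [Matrix.of_apply] using hanti i j) hl (h l)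
      exact this

/-- The last index of the components in question is radial, so the complementary components of the
field are those tangent to the sphere. -/
lemma sphField_eq_zero_iff_spaceHodge (hB : ContDiff ℝ ∞ B) (hclosed : ∀ x, extDeriv B x = 0)
    {r : ℝ} (hr : 0 < r) (σ : Sph (m + 2)) :
    sphField B r σ = 0 ↔ ∀ l : Fin m → Fin (m + 2), spaceHodge B r σ
      (Fin.snoc (fun i => (l i).castSucc) (Fin.last (m + 2))) = 0 := by
  have hentry : ∀ a b : Fin (m + 2),
      B (dilate r σ) ![sphericalFrame r σ a.castSucc, sphericalFrame r σ b.castSucc] =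
        sphField B r σ ![coordVec σ a, coordVec σ b] := by
    intro a b
    have h1 := sphField_apply hB hclosed r σ (coordVec σ a) (coordVec σ b)
    refine Eq.trans ?_ h1.symm
    simp only [sphericalFrame, Fin.snoc_castSucc]
    rw [← bilin_apply, ← bilin_apply]
    simp only [map_smul, _root_.smul_apply, smul_eq_mul]
    ring
  rw [sphField_eq_zero_iff]
  refine ⟨fun h l => hodgeDual_eq_zero (k := m + 1) fun i j hi hj => ?_, fun h a b => ?_⟩
  · rw [Matrix.of_apply]
    have hi' := hi (Fin.last m)
    have hj' := hj (Fin.last m)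
    rw [Fin.snoc_last] at hi' hj'
    obtain ⟨a, rfl⟩ := Fin.exists_castSucc_eq.2 hi'.symm
    obtain ⟨b, rfl⟩ := Fin.exists_castSucc_eq.2 hj'.symm
    rw [hentry, h]
  · have hanti : ∀ i j : Fin (m + 3),
        B (dilate r σ) ![sphericalFrame r σ j, sphericalFrame r σ i] =
        -B (dilate r σ) ![sphericalFrame r σ i, sphericalFrame r σ j] := fun i j =>
      twoForm_swap _ _ _
    by_cases hab : a = b
    · have := hanti a.castSucc b.castSucc
      rw [hab] at this ⊢
      rw [← hentry]
      linarith
    · obtain ⟨l, hl⟩ := exists_complementary hab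
      rw [← hentry]
      refine eq_zero_of_hodgeDual_eq_zero (k := m + 1)
        (β := Matrix.of fun j k => B (dilate r σ) ![sphericalFrame r σ j, sphericalFrame r σ k])
        (a := a.castSucc) (b := b.castSucc)
        (orientationSign_ne_zero σ) ?_ hanti ?_ (h l)
      · rw [det_gram_sphericalFrame]
        positivity
      · rw [snoc_injective_iff, snoc_injective_iff] at hl
        obtain ⟨⟨h1, h2⟩, h3⟩ := hl
        have h4 : ∀ t, l t ≠ b := fun t => by simpa using h3 t.castSucc
        rw [snoc_injective_iff, snoc_injective_iff, snoc_injective_iff]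
        refine ⟨⟨⟨fun s t hst => h1 (Fin.castSucc_injective _ hst),
          fun t => (Fin.castSucc_lt_last _).ne⟩, fun t => ?_⟩, fun t => ?_⟩
        · refine Fin.lastCases ?_ (fun t => ?_) t
          · simpa using (Fin.castSucc_lt_last a).ne'
          · simpa using h2 t
        · refine Fin.lastCases ?_ (fun t => Fin.lastCases ?_ (fun t => ?_) t) t
          · simpa using hab
          · simpa using (Fin.castSucc_lt_last b).ne'
          · simpa using h4 t

end HodgeEquivalences

/-! ### Rotations in a plane -/

section Rotations

variable {E : Type} [NormedAddCommGroup E] [InnerProductSpace ℝ E] {u v : E}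

/-- The infinitesimal rotation in the plane spanned by `u` and `v`. -/
def rotField (u v : E) : E →L[ℝ] E :=
  (innerSL ℝ u).smulRight v - (innerSL ℝ v).smulRight u

lemma rotField_apply (u v x : E) : rotField u v x = inner ℝ u x • v - inner ℝ v x • u := rfl

/-- The rotation by the angle `t` in the plane spanned by the orthonormal vectors `u` and `v`. -/
def rotCLM (u v : E) (t : ℝ) : E →L[ℝ] E :=
  ContinuousLinearMap.id ℝ E +
    ((Real.cos t - 1) • ((innerSL ℝ u).smulRight u + (innerSL ℝ v).smulRight v) +
      Real.sin t • rotField u v)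

lemma rotCLM_apply (u v : E) (t : ℝ) (x : E) :
    rotCLM u v t x = x + ((Real.cos t - 1) • (inner ℝ u x • u + inner ℝ v x • v) +
      Real.sin t • rotField u v x) := rfl

lemma inner_self_rotField (u v x : E) : inner ℝ x (rotField u v x) = 0 := by
  rw [rotField_apply, inner_sub_right, inner_smul_right, inner_smul_right, real_inner_comm v x,
    real_inner_comm u x]
  ring

/-- An orthonormal pair. -/
structure IsOrthonormalPair (u v : E) : Prop where
  left : ‖u‖ = 1
  right : ‖v‖ = 1
  orth : inner ℝ u v = 0

namespace IsOrthonormalPair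

lemma inner_left (h : IsOrthonormalPair u v) : inner ℝ u u = 1 := by
  rw [real_inner_self_eq_norm_sq, h.left, one_pow]

lemma inner_right (h : IsOrthonormalPair u v) : inner ℝ v v = 1 := by
  rw [real_inner_self_eq_norm_sq, h.right, one_pow]

lemma orth' (h : IsOrthonormalPair u v) : inner ℝ v u = 0 := by
  rw [real_inner_comm, h.orth]

lemma inner_left_rotCLM (h : IsOrthonormalPair u v) (t : ℝ) (x : E) :
    inner ℝ u (rotCLM u v t x) = Real.cos t * inner ℝ u x - Real.sin t * inner ℝ v x := by
  rw [rotCLM_apply, rotField_apply]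
  simp only [inner_add_right, inner_smul_right, inner_sub_right, h.inner_left, h.orth]
  ring

lemma inner_right_rotCLM (h : IsOrthonormalPair u v) (t : ℝ) (x : E) :
    inner ℝ v (rotCLM u v t x) = Real.sin t * inner ℝ u x + Real.cos t * inner ℝ v x := by
  rw [rotCLM_apply, rotField_apply]
  simp only [inner_add_right, inner_smul_right, inner_sub_right, h.inner_right, h.orth']
  ring

lemma rotField_rotCLM (h : IsOrthonormalPair u v) (t : ℝ) (x : E) :
    rotField u v (rotCLM u v t x) =
      (-Real.sin t) • (inner ℝ u x • u + inner ℝ v x • v) + Real.cos t • rotField u v x := by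
  rw [rotField_apply, h.inner_left_rotCLM, h.inner_right_rotCLM, rotField_apply]
  module

lemma rotCLM_neg_rotCLM (h : IsOrthonormalPair u v) (t : ℝ) (x : E) :
    rotCLM u v (-t) (rotCLM u v t x) = x := by
  rw [rotCLM_apply (t := -t), h.rotField_rotCLM, h.inner_left_rotCLM, h.inner_right_rotCLM,
    rotCLM_apply, rotField_apply, Real.cos_neg, Real.sin_neg]
  match_scalars
  · ring
  · linear_combination (inner ℝ u x) * Real.sin_sq_add_cos_sq t
  · linear_combination (inner ℝ v x) * Real.sin_sq_add_cos_sq t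

lemma norm_rotCLM (h : IsOrthonormalPair u v) (t : ℝ) (x : E) : ‖rotCLM u v t x‖ = ‖x‖ := by
  have h2 : inner ℝ (rotCLM u v t x) (rotCLM u v t x) = inner ℝ x x := by
    rw [rotCLM_apply, rotField_apply]
    simp only [inner_add_left, inner_add_right, inner_sub_left, inner_sub_right, inner_smul_left,
      inner_smul_right, h.inner_left, h.inner_right, h.orth, h.orth', conj_trivial,
      real_inner_comm u x, real_inner_comm v x]
    linear_combination (inner ℝ u x ^ 2 + inner ℝ v x ^ 2) * Real.sin_sq_add_cos_sq t
  rw [real_inner_self_eq_norm_sq, real_inner_self_eq_norm_sq] at h2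
  exact (sq_eq_sq₀ (norm_nonneg _) (norm_nonneg _)).1 h2

lemma hasDerivAt_rotCLM (h : IsOrthonormalPair u v) (x : E) (t : ℝ) :
    HasDerivAt (fun t => rotCLM u v t x) (rotField u v (rotCLM u v t x)) t := by
  rw [h.rotField_rotCLM]
  simp only [rotCLM_apply]
  exact ((((Real.hasDerivAt_cos t).sub_const 1).smul_const _).add
    ((Real.hasDerivAt_sin t).smul_const _)).const_add x

lemma norm_rotField_le (h : IsOrthonormalPair u v) (x : E) : ‖rotField u v x‖ ≤ ‖x‖ := by
  have h1 : ‖rotField u v x‖ ^ 2 = inner ℝ u x ^ 2 + inner ℝ v x ^ 2 := by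
    rw [← real_inner_self_eq_norm_sq, rotField_apply]
    simp only [inner_sub_left, inner_sub_right, inner_smul_left, inner_smul_right, h.inner_left,
      h.inner_right, h.orth, h.orth', conj_trivial]
    ring
  have h2 : inner ℝ (x - (inner ℝ u x • u + inner ℝ v x • v))
      (x - (inner ℝ u x • u + inner ℝ v x • v)) =
      ‖x‖ ^ 2 - (inner ℝ u x ^ 2 + inner ℝ v x ^ 2) := by
    simp only [inner_sub_left, inner_sub_right, inner_add_left, inner_add_right, inner_smul_left,
      inner_smul_right, h.inner_left, h.inner_right, h.orth, h.orth', conj_trivial,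
      real_inner_comm u x, real_inner_comm v x, real_inner_self_eq_norm_sq]
    ring
  have h3 := real_inner_self_nonneg (x := x - (inner ℝ u x • u + inner ℝ v x • v))
  refine (sq_le_sq₀ (norm_nonneg _) (norm_nonneg _)).1 ?_
  linarith

/-- The rotation, as a linear isometry of the ambient space. -/
def rotation (h : IsOrthonormalPair u v) (t : ℝ) : E ≃ₗᵢ[ℝ] E where
  toLinearEquiv := LinearEquiv.ofLinearMap (rotCLM u v t : E →ₗ[ℝ] E) (rotCLM u v (-t) : E →ₗ[ℝ] E)
    (by
      ext x
      have := h.rotCLM_neg_rotCLM (-t) x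
      rwa [neg_neg] at this)
    (by
      ext x
      exact h.rotCLM_neg_rotCLM t x)
  norm_map' := h.norm_rotCLM t

end IsOrthonormalPair

lemma rotCLM_two_pi (u v x : E) : rotCLM u v (2 * Real.pi) x = x := by
  simp [rotCLM_apply]

/-- Any two unit vectors are related by a plane rotation. -/
lemma exists_rotation [FiniteDimensional ℝ E] (hdim : 2 ≤ Module.finrank ℝ E) {x y : E}
    (hx : ‖x‖ = 1) (hy : ‖y‖ = 1) :
    ∃ (w : E) (_ : IsOrthonormalPair x w) (t : ℝ), 0 ≤ t ∧ rotCLM x w t x = y := by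
  have hxx : inner ℝ x x = 1 := by rw [real_inner_self_eq_norm_sq, hx, one_pow]
  have hyy : inner ℝ y y = 1 := by rw [real_inner_self_eq_norm_sq, hy, one_pow]
  set c := inner ℝ x y with hc
  have hyx : inner ℝ y x = c := real_inner_comm _ _
  -- a unit vector orthogonal to `x` in the direction of the component of `y`
  obtain ⟨w, hw, hyw⟩ : ∃ w : E, IsOrthonormalPair x w ∧ y - c • x = ‖y - c • x‖ • w := by
    by_cases h0 : y - c • x = 0
    · obtain ⟨w, hw, hne⟩ : ∃ w ∈ (ℝ ∙ x)ᗮ, w ≠ 0 := by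
        apply Submodule.exists_mem_ne_zero_of_ne_bot
        intro hbot
        have h1 := Submodule.finrank_add_finrank_orthogonal (ℝ ∙ x)
        rw [hbot, finrank_bot, finrank_span_singleton (by rintro rfl; simp at hx)] at h1
        omega
      rw [Submodule.mem_orthogonal_singleton_iff_inner_right] at hw
      refine ⟨‖w‖⁻¹ • w, ⟨hx, norm_smul_inv_norm (𝕜 := ℝ) hne, ?_⟩, ?_⟩
      · rw [inner_smul_right, hw, mul_zero]
      · rw [h0, norm_zero, zero_smul]
    · refine ⟨‖y - c • x‖⁻¹ • (y - c • x), ⟨hx, norm_smul_inv_norm (𝕜 := ℝ) h0, ?_⟩, ?_⟩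
      · rw [inner_smul_right, inner_sub_right, inner_smul_right, hxx, ← hc]
        ring
      · rw [smul_inv_smul₀ (norm_ne_zero_iff.2 h0)]
  have hnorm : ‖y - c • x‖ ^ 2 = 1 - c ^ 2 := by
    rw [← real_inner_self_eq_norm_sq]
    simp only [inner_sub_left, inner_sub_right, inner_smul_left, inner_smul_right, hxx, hyy, hyx,
      ← hc, conj_trivial]
    ring
  have hcle : |c| ≤ 1 := by
    have := abs_real_inner_le_norm x y
    rwa [hx, hy, one_mul] at this
  refine ⟨w, hw, Real.arccos c, Real.arccos_nonneg c, ?_⟩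
  have hsin : Real.sin (Real.arccos c) = ‖y - c • x‖ := by
    rw [Real.sin_arccos, ← hnorm, Real.sqrt_sq (norm_nonneg _)]
  rw [rotCLM_apply, rotField_apply, hsin, Real.cos_arccos (abs_le.1 hcle).1 (abs_le.1 hcle).2, hxx,
    hw.orth']
  simp only [one_smul, zero_smul, add_zero, sub_zero]
  rw [← hyw]
  module

end Rotations

section RotatedMeasure

variable {n : ℕ}

/-- The action of a linear isometry on the unit sphere. -/
def sphMap (e : Space n ≃ₗᵢ[ℝ] Space n) (σ : Sph n) : Sph n :=
  ⟨e σ, by simp⟩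

lemma continuous_sphMap (e : Space n ≃ₗᵢ[ℝ] Space n) : Continuous (sphMap e) :=
  (e.continuous.comp continuous_subtype_val).subtype_mk _

open scoped Pointwise in
/-- The surface measure is invariant under linear isometries. -/
lemma measurePreserving_sphMap (e : Space n ≃ₗᵢ[ℝ] Space n) :
    MeasurePreserving (sphMap e) (surfaceMeasure n) (surfaceMeasure n) := by
  refine ⟨(continuous_sphMap e).measurable, ?_⟩
  ext s hs
  rw [Measure.map_apply (continuous_sphMap e).measurable hs, surfaceMeasure,
    Measure.toSphere_apply' _ hs, Measure.toSphere_apply' _ ((continuous_sphMap e).measurable hs)]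
  congr 1
  have hset : (Set.Ioo (0 : ℝ) 1 • (Subtype.val '' (sphMap e ⁻¹' s)) : Set (Space n)) =
      e ⁻¹' (Set.Ioo (0 : ℝ) 1 • (Subtype.val '' s)) := by
    ext x
    simp only [Set.mem_smul, Set.mem_image, Set.mem_preimage]
    constructor
    · rintro ⟨t, ht, _, ⟨σ, hσ, rfl⟩, rfl⟩
      exact ⟨t, ht, _, ⟨_, hσ, rfl⟩, by simp [sphMap]⟩
    · rintro ⟨t, ht, _, ⟨σ, hσ, rfl⟩, hx⟩
      refine ⟨t, ht, _, ⟨sphMap e.symm σ, ?_, rfl⟩, ?_⟩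
      · have : sphMap e (sphMap e.symm σ) = σ := by ext1; simp [sphMap]
        rwa [this]
      · have := congrArg e.symm hx
        simpa [sphMap] using this
  rw [hset]
  exact e.measurePreserving.measure_preimage_emb e.toHomeomorph.measurableEmbedding _

lemma measurableEmbedding_sphMap (e : Space n ≃ₗᵢ[ℝ] Space n) :
    MeasurableEmbedding (sphMap e) := by
  refine ((continuous_sphMap e).isClosedEmbedding ?_).measurableEmbedding
  intro σ τ h
  ext1
  exact e.injective (congrArg Subtype.val h)

end RotatedMeasure

/-! ### Functions on the sphere as functions on the ambient space -/

section RadialExtension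

variable {n : ℕ}

/-- The radial projection onto the unit sphere (with an arbitrary value at the origin). -/
def sphProj (x : Space n) : Sph n :=
  if h : x = 0 then ⟨EuclideanSpace.single 0 1, by simp⟩
  else ⟨‖x‖⁻¹ • x, by simpa using norm_smul_inv_norm (𝕜 := ℝ) h⟩

lemma coe_sphProj {x : Space n} (h : x ≠ 0) : (sphProj x : Space n) = ‖x‖⁻¹ • x := by
  simp [sphProj, h]

lemma sphere_ne_zero (σ : Sph n) : (σ : Space n) ≠ 0 := ne_zero_of_mem_unit_sphere σ

lemma sphProj_coe (σ : Sph n) : sphProj (σ : Space n) = σ := by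
  ext1
  rw [coe_sphProj (sphere_ne_zero σ), norm_sphere, inv_one, one_smul]

lemma contDiffAt_normalize {x : Space n} (h : x ≠ 0) :
    ContDiffAt ℝ ∞ (fun x : Space n => ‖x‖⁻¹ • x) x :=
  ((contDiffAt_norm ℝ h).inv (norm_ne_zero_iff.2 h)).smul contDiffAt_id

/-- The radial projection is smooth away from the origin: in the chart centred at the image, it is
the composition of normalisation with the stereographic projection. -/
lemma contMDiffAt_sphProj {x : Space n} (h : x ≠ 0) :
    ContMDiffAt 𝓘(ℝ, Space n) (𝓡 n) ∞ (sphProj (n := n)) x := by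
  have hev : (fun y : Space n => (sphProj y : Space n)) =ᶠ[𝓝 x] fun y => ‖y‖⁻¹ • y := by
    filter_upwards [isOpen_compl_singleton.mem_nhds h] with y hy
    exact coe_sphProj hy
  rw [contMDiffAt_iff_target]
  refine ⟨?_, ?_⟩
  · refine Topology.IsInducing.subtypeVal.continuousAt_iff.2 ?_
    exact (contDiffAt_normalize h).continuousAt.congr hev.symm
  · have := Fact.mk (@finrank_euclideanSpace_fin ℝ _ (n + 1))
    set p : Sph n := sphProj x with hp
    let U := (OrthonormalBasis.fromOrthogonalSpanSingleton (𝕜 := ℝ) n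
      (ne_zero_of_mem_unit_sphere (-p))).repr
    have hst : ContDiffAt ℝ ∞ (stereoToFun ((-p : Sph n) : Space n)) (p : Space n) := by
      refine contDiffOn_stereoToFun.contDiffAt (IsOpen.mem_nhds ?_ ?_)
      · exact isOpen_ne_fun (by fun_prop) continuous_const
      · simp only [Set.mem_ofPred_eq, innerSL_apply_apply]
        rw [show ((-p : Sph n) : Space n) = -(p : Space n) from rfl, inner_neg_left,
          real_inner_self_eq_norm_sq, norm_sphere]
        norm_num
    have hcomp : ContDiffAt ℝ ∞ (fun y : Space n =>
        U (stereoToFun ((-p : Sph n) : Space n) (sphProj y : Space n))) x := by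
      have h1 := ContDiffAt.comp (f := fun y : Space n => (sphProj y : Space n)) x hst
        ((contDiffAt_normalize h).congr_of_eventuallyEq hev)
      exact U.contDiff.contDiffAt.comp x h1
    exact hcomp.contMDiffAt

/-- The extension of a function on the sphere that is constant along rays. -/
def radialExt (ψ : Sph n → ℂ) (x : Space n) : ℂ := ψ (sphProj x)

lemma radialExt_coe (ψ : Sph n → ℂ) (σ : Sph n) : radialExt ψ σ = ψ σ := by
  rw [radialExt, sphProj_coe]

lemma contDiffAt_radialExt {ψ : Sph n → ℂ} (hψ : ContMDiff (𝓡 n) 𝓘(ℝ, ℂ) ∞ ψ) {x : Space n}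
    (h : x ≠ 0) : ContDiffAt ℝ ∞ (radialExt ψ) x :=
  ((hψ (sphProj x)).comp x (contMDiffAt_sphProj h)).contDiffAt

lemma hasFDerivAt_radialExt {ψ : Sph n → ℂ} (hψ : ContMDiff (𝓡 n) 𝓘(ℝ, ℂ) ∞ ψ) {x : Space n}
    (h : x ≠ 0) : HasFDerivAt (radialExt ψ) (fderiv ℝ (radialExt ψ) x) x :=
  ((contDiffAt_radialExt hψ h).differentiableAt (by simp)).hasFDerivAt

lemma continuous_fderiv_radialExt {ψ : Sph n → ℂ} (hψ : ContMDiff (𝓡 n) 𝓘(ℝ, ℂ) ∞ ψ) :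
    Continuous fun σ : Sph n => fderiv ℝ (radialExt ψ) (σ : Space n) := by
  refine continuous_iff_continuousAt.2 fun σ => ?_
  exact ((contDiffAt_radialExt hψ (sphere_ne_zero σ)).continuousAt_fderiv (by simp)).comp
    continuous_subtype_val.continuousAt

/-- The differential on the sphere is the restriction of that of the radial extension. -/
lemma mvfderiv_eq_radialExt {ψ : Sph n → ℂ} (hψ : ContMDiff (𝓡 n) 𝓘(ℝ, ℂ) ∞ ψ) (σ : Sph n) :
    mvfderiv (𝓡 n) ψ σ = (fderiv ℝ (radialExt ψ) σ).comp (tangentIncl σ) := by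
  have h := mvfderiv_comp_coe σ (hasFDerivAt_radialExt hψ (sphere_ne_zero σ))
  simpa only [radialExt_coe] using h

end RadialExtension

/-! ### The covariant derivative and its norm -/

section CovariantDerivative

variable {n : ℕ}

/-- The covariant derivative `d - i α` of a function with value `z` and differential `β` at some
point of the ambient space. -/
def covDiff (a : Space n →L[ℝ] ℝ) (z : ℂ) (β : Space n →L[ℝ] ℂ) : Space n →L[ℝ] ℂ :=
  β - (Complex.I * z) • Complex.ofRealCLM.comp a

lemma covDiff_apply (a : Space n →L[ℝ] ℝ) (z : ℂ) (β : Space n →L[ℝ] ℂ) (v : Space n) :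
    covDiff a z β v = β v - Complex.I * z * (a v : ℂ) := rfl

/-- The magnetic differential on the sphere is the restriction of the ambient covariant derivative
for the scaled potential. -/
lemma magneticDiff_restrict (B : Space n → Space n [⋀^Fin 2]→L[ℝ] ℝ) (r : ℝ) (σ : Sph n) (z : ℂ)
    (β : Space n →L[ℝ] ℂ) :
    magneticDiff B r σ z (β.comp (tangentIncl σ)) =
      (covDiff (scaledPotential B r σ) z β).comp (tangentIncl σ) := by
  rw [magneticDiff, sphPotential_eq]
  rfl

/-- The squared norm of the restriction of a covector to the tangent space of the sphere. -/
def tangentialNormSq (σ : Sph n) (L : Space n →L[ℝ] ℂ) : ℝ :=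
  covectorNormSq σ (L.comp (tangentIncl σ))

lemma tangentialNormSq_eq (σ : Sph n) (L : Space n →L[ℝ] ℂ) :
    tangentialNormSq σ L = ∑ μ, ‖L (modelIsometry σ (EuclideanSpace.single μ 1))‖ ^ 2 := by
  rw [tangentialNormSq, covectorNormSq_eq]
  refine Finset.sum_congr rfl fun μ _ => ?_
  rw [← tangentIncl_apply]
  rfl

lemma tangentialNormSq_nonneg (σ : Sph n) (L : Space n →L[ℝ] ℂ) : 0 ≤ tangentialNormSq σ L := by
  rw [tangentialNormSq_eq]
  positivity

/-- The Cauchy-Schwarz inequality for the pairing of a covector with a tangent vector. -/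
lemma norm_sq_apply_le (σ : Sph n) (L : Space n →L[ℝ] ℂ) {w : Space n}
    (hw : inner ℝ (σ : Space n) w = 0) : ‖L w‖ ^ 2 ≤ ‖w‖ ^ 2 * tangentialNormSq σ L := by
  obtain ⟨v, hv⟩ := exists_tangentIncl_eq σ hw
  rw [tangentIncl_apply] at hv
  have hsum : L w = ∑ μ, (v μ) • L (modelIsometry σ (EuclideanSpace.single μ 1)) := by
    have h1 : v = ∑ μ, v μ • EuclideanSpace.single μ (1 : ℝ) := by
      have := (EuclideanSpace.basisFun (Fin n) ℝ).sum_repr v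
      simpa using this.symm
    conv_lhs => rw [← hv, h1]
    simp only [map_sum, map_smul]
  have hnorm : ‖w‖ ^ 2 = ∑ μ, ‖v μ‖ ^ 2 := by
    rw [← hv, (modelIsometry σ).norm_map, EuclideanSpace.norm_sq_eq]
  rw [hnorm, tangentialNormSq_eq, hsum]
  calc ‖∑ μ, (v μ) • L (modelIsometry σ (EuclideanSpace.single μ 1))‖ ^ 2
      ≤ (∑ μ, ‖v μ‖ * ‖L (modelIsometry σ (EuclideanSpace.single μ 1))‖) ^ 2 := by
        gcongr
        refine (norm_sum_le _ _).trans (Finset.sum_le_sum fun μ _ => ?_)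
        rw [norm_smul]
    _ ≤ _ := Finset.sum_mul_sq_le_sq_mul_sq _ _ _

/-- The Hilbert-Schmidt norm of a complex covector does not depend on the orthonormal basis. -/
lemma sum_norm_sq_apply_eq {ι E : Type*} [Fintype ι] [NormedAddCommGroup E] [InnerProductSpace ℝ E]
    [CompleteSpace E] (L : E →L[ℝ] ℂ) (b b' : OrthonormalBasis ι ℝ E) :
    ∑ i, ‖L (b i)‖ ^ 2 = ∑ i, ‖L (b' i)‖ ^ 2 := by
  have hreal : ∀ (ℓ : E →L[ℝ] ℝ) (c : OrthonormalBasis ι ℝ E),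
      ∑ i, ℓ (c i) ^ 2 = ‖(InnerProductSpace.toDual ℝ E).symm ℓ‖ ^ 2 := by
    intro ℓ c
    rw [← c.sum_sq_norm_inner_right]
    refine Finset.sum_congr rfl fun i _ => ?_
    rw [← real_inner_comm (c i), InnerProductSpace.toDual_symm_apply, Real.norm_eq_abs, sq_abs]
  have hsplit : ∀ z : ℂ, ‖z‖ ^ 2 = z.re ^ 2 + z.im ^ 2 := fun z => by
    rw [← Complex.normSq_eq_norm_sq, Complex.normSq_apply]
    ring
  have h1 : ∀ c : OrthonormalBasis ι ℝ E, ∑ i, ‖L (c i)‖ ^ 2 =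
      ‖(InnerProductSpace.toDual ℝ E).symm (Complex.reCLM.comp L)‖ ^ 2 +
      ‖(InnerProductSpace.toDual ℝ E).symm (Complex.imCLM.comp L)‖ ^ 2 := by
    intro c
    rw [← hreal _ c, ← hreal _ c, ← Finset.sum_add_distrib]
    exact Finset.sum_congr rfl fun i _ => hsplit _
  rw [h1, h1]

/-- An expression for the tangential norm that depends on `σ` continuously, since it does not
refer to the charts. -/
lemma tangentialNormSq_eq_sub (σ : Sph n) (L : Space n →L[ℝ] ℂ) :
    tangentialNormSq σ L = ∑ i, ‖L (EuclideanSpace.single i 1)‖ ^ 2 - ‖L σ‖ ^ 2 := by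
  -- the coordinate frame at `σ` and `σ` itself form an orthonormal basis of the ambient space
  have hon : Orthonormal ℝ (sphericalFrame 1 σ) := by
    rw [orthonormal_iff_ite]
    intro i j
    have := congrFun (congrFun (gram_sphericalFrame 1 σ) i) j
    rw [Matrix.of_apply, Matrix.diagonal_apply] at this
    rw [this]
    congr 1
    refine Fin.lastCases ?_ (fun i => ?_) i <;> simp
  obtain ⟨b, hb⟩ := Orthonormal.exists_orthonormalBasis_extension_of_card_eq (𝕜 := ℝ)
    (E := Space n) (ι := Fin (n + 1)) (by simp) (v := sphericalFrame 1 σ) (s := Set.univ)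
    (by
      rw [orthonormal_iff_ite] at hon ⊢
      intro i j
      rw [Set.domRestrict_apply, Set.domRestrict_apply, hon]
      simp only [Subtype.ext_iff])
  have h1 := sum_norm_sq_apply_eq L b (EuclideanSpace.basisFun (Fin (n + 1)) ℝ)
  simp only [EuclideanSpace.basisFun_apply] at h1
  rw [← h1, Fin.sum_univ_castSucc, hb _ trivial, tangentialNormSq_eq]
  simp only [hb _ (Set.mem_univ _)]
  simp only [sphericalFrame, Fin.snoc_last, Fin.snoc_castSucc, one_smul, add_sub_cancel_right]
  refine Finset.sum_congr rfl fun μ _ => ?_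
  rw [← tangentIncl_apply]
  rfl

end CovariantDerivative

/-! ### Parallel transport along circles -/

section KeyEstimate

/-- The Cauchy-Schwarz inequality on an interval. -/
lemma sq_integral_le {f : ℝ → ℝ} (hf : Continuous f) {T : ℝ} (hT : 0 ≤ T) :
    (∫ t in (0 : ℝ)..T, f t) ^ 2 ≤ T * ∫ t in (0 : ℝ)..T, f t ^ 2 := by
  rcases hT.eq_or_lt with rfl | hT'
  · simp
  set I := ∫ t in (0 : ℝ)..T, f t with hI
  have h0 : 0 ≤ ∫ t in (0 : ℝ)..T, (T * f t - I) ^ 2 :=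
    intervalIntegral.integral_nonneg hT fun t _ => sq_nonneg _
  have h1 : ∫ t in (0 : ℝ)..T, (T * f t - I) ^ 2 =
      T ^ 2 * (∫ t in (0 : ℝ)..T, f t ^ 2) - 2 * T * I * I + T * I ^ 2 := by
    have : ∀ t, (T * f t - I) ^ 2 = T ^ 2 * f t ^ 2 - 2 * T * I * f t + I ^ 2 := fun t => by ring
    simp only [this]
    rw [intervalIntegral.integral_add, intervalIntegral.integral_sub,
      intervalIntegral.integral_const_mul, intervalIntegral.integral_const_mul,
      intervalIntegral.integral_const, ← hI]
    · simp
    all_goals exact Continuous.intervalIntegrable (by fun_prop) _ _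
  rw [h1] at h0
  have h2 : 0 ≤ T * (T * (∫ t in (0 : ℝ)..T, f t ^ 2) - I ^ 2) := by linarith
  have := nonneg_of_mul_nonneg_right h2 hT'
  linarith

section Curve

variable {E : Type} [NormedAddCommGroup E] [NormedSpace ℝ E]

lemma continuous_pairing {X : Type*} [TopologicalSpace X] {α : E → E →L[ℝ] ℝ} (hα : Continuous α)
    (M : E →L[ℝ] E) {γ : X → E} (hγ : Continuous γ) : Continuous fun x => α (γ x) (M (γ x)) :=
  (hα.comp hγ).clm_apply (M.continuous.comp hγ)

/-- Parallel transport along an integral curve of a vector field changes a function at most by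
the integral of its covariant derivative. -/
lemma norm_sq_parallel_sub_le {α : E → E →L[ℝ] ℝ} (hα : Continuous α) {X : E →L[ℝ] E}
    {Ψ : E → ℂ} {γ : ℝ → E} (hγ : ∀ t, HasDerivAt γ (X (γ t)) t)
    (hΨ : ∀ t, ContDiffAt ℝ 1 Ψ (γ t)) {T : ℝ} (hT : 0 ≤ T) :
    ‖Complex.exp (-(Complex.I * (∫ t in (0 : ℝ)..T, α (γ t) (X (γ t)) : ℝ))) * Ψ (γ T)
      - Ψ (γ 0)‖ ^ 2 ≤ T * ∫ t in (0 : ℝ)..T,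
        ‖fderiv ℝ Ψ (γ t) (X (γ t)) - Complex.I * Ψ (γ t) * (α (γ t) (X (γ t)) : ℝ)‖ ^ 2 := by
  have hγc : Continuous γ := continuous_iff_continuousAt.2 fun t => (hγ t).continuousAt
  set a : ℝ → ℝ := fun t => α (γ t) (X (γ t)) with ha
  have hac : Continuous a := continuous_pairing hα X hγc
  set D : ℝ → ℂ := fun t => fderiv ℝ Ψ (γ t) (X (γ t)) - Complex.I * Ψ (γ t) * (a t : ℝ) with hD
  set θ : ℝ → ℝ := fun t => ∫ s in (0 : ℝ)..t, a s with hθ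
  have hθd : ∀ t, HasDerivAt θ (a t) t := fun t =>
    intervalIntegral.integral_hasDerivAt_right (hac.intervalIntegrable _ _)
      (hac.stronglyMeasurableAtFilter _ _) hac.continuousAt
  have hΨd : ∀ t, HasDerivAt (fun t => Ψ (γ t)) (fderiv ℝ Ψ (γ t) (X (γ t))) t :=
    fun t => ((hΨ t).differentiableAt one_ne_zero).hasFDerivAt.comp_hasDerivAt t (hγ t)
  have hDc : Continuous D := by
    have h1 : Continuous fun t => fderiv ℝ Ψ (γ t) := continuous_iff_continuousAt.2 fun t =>
      ((hΨ t).continuousAt_fderiv one_ne_zero).comp hγc.continuousAt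
    have h2 : Continuous fun t => Ψ (γ t) :=
      continuous_iff_continuousAt.2 fun t => (hΨd t).continuousAt
    exact (h1.clm_apply (X.continuous.comp hγc)).sub
      ((continuous_const.mul h2).mul (Complex.continuous_ofReal.comp hac))
  set g : ℝ → ℂ := fun t => Complex.exp (-(Complex.I * θ t)) * Ψ (γ t) with hg
  have hgd : ∀ t, HasDerivAt g (Complex.exp (-(Complex.I * θ t)) * D t) t := by
    intro t
    have h1 : HasDerivAt (fun t => -(Complex.I * (θ t : ℂ))) (-(Complex.I * (a t : ℂ))) t :=
      ((hθd t).ofReal_comp.const_mul Complex.I).neg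
    refine (h1.cexp.mul (hΨd t)).congr_deriv ?_
    simp only [hD]
    ring
  have hphase : ∀ t, ‖Complex.exp (-(Complex.I * θ t))‖ = 1 := by
    intro t
    rw [Complex.norm_exp]
    simp
  have hθc : Continuous θ := continuous_iff_continuousAt.2 fun t => (hθd t).continuousAt
  have hint : g T - Ψ (γ 0) = ∫ t in (0 : ℝ)..T, Complex.exp (-(Complex.I * θ t)) * D t := by
    rw [intervalIntegral.integral_eq_sub_of_hasDerivAt (fun t _ => hgd t)]
    · have h1 : g 0 = Ψ (γ 0) := by simp [hg, hθ]
      rw [h1]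
    · refine Continuous.intervalIntegrable ?_ _ _
      have : Continuous fun t => (θ t : ℂ) := Complex.continuous_ofReal.comp hθc
      fun_prop
  have hle : ‖g T - Ψ (γ 0)‖ ≤ ∫ t in (0 : ℝ)..T, ‖D t‖ := by
    rw [hint]
    refine (intervalIntegral.norm_integral_le_integral_norm hT).trans_eq ?_
    congr 1
    ext t
    rw [norm_mul, hphase, one_mul]
  calc ‖g T - Ψ (γ 0)‖ ^ 2 ≤ (∫ t in (0 : ℝ)..T, ‖D t‖) ^ 2 := by gcongr
    _ ≤ T * ∫ t in (0 : ℝ)..T, ‖D t‖ ^ 2 := sq_integral_le hDc.norm hT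

end Curve

/-- The phase acquired by parallel transport along the orbit of `x` under rotations up to angle
`T`: the integral of the 1-form `α` along the arc. -/
def holonomy {E : Type} [NormedAddCommGroup E] [InnerProductSpace ℝ E] (α : E → E →L[ℝ] ℝ)
    (u v : E) (T : ℝ) (x : E) : ℝ :=
  ∫ t in (0 : ℝ)..T, α (rotCLM u v t x) (rotField u v (rotCLM u v t x))

lemma continuous_holonomy {E : Type} [NormedAddCommGroup E] [InnerProductSpace ℝ E]
    {α : E → E →L[ℝ] ℝ} (hα : Continuous α) (u v : E) (T : ℝ) :
    Continuous (holonomy α u v T) := by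
  have h1 : Continuous fun p : E × ℝ => rotCLM u v p.2 p.1 := by
    simp only [rotCLM_apply]
    fun_prop
  have h2 : Continuous fun p : E × ℝ =>
      α (rotCLM u v p.2 p.1) (rotField u v (rotCLM u v p.2 p.1)) :=
    continuous_pairing hα (rotField u v) h1
  exact intervalIntegral.continuous_parametric_intervalIntegral_of_continuous'
    (f := fun (x : E) (t : ℝ) => α (rotCLM u v t x) (rotField u v (rotCLM u v t x))) h2 0 T

variable {n : ℕ} {u v : Space n}

/-- Parallel transport back to `σ` of the value of `ψ` at the point of angle `T` on the orbit
of `σ`. -/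
def transport (α : Space n → Space n →L[ℝ] ℝ) (u v : Space n) (T : ℝ) (ψ : Sph n → ℂ)
    (σ : Sph n) : ℂ :=
  Complex.exp (-(Complex.I * holonomy α u v T (σ : Space n))) * radialExt ψ (rotCLM u v T σ)

/-- The magnetic differential `dψ - i α ψ`, for the extension of `ψ` that is constant along
rays. -/
def magneticGrad (α : Space n → Space n →L[ℝ] ℝ) (ψ : Sph n → ℂ) (σ : Sph n) :
    Space n →L[ℝ] ℂ :=
  covDiff (α σ) (ψ σ) (fderiv ℝ (radialExt ψ) σ)

/-- The pointwise estimate for parallel transport of functions on the sphere along orbits of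
rotations. -/
lemma norm_sq_transport_sub_le {α : Space n → Space n →L[ℝ] ℝ} (hα : Continuous α)
    (h : IsOrthonormalPair u v) {ψ : Sph n → ℂ} (hψ : ContMDiff (𝓡 n) 𝓘(ℝ, ℂ) ∞ ψ)
    {T : ℝ} (hT : 0 ≤ T) (σ : Sph n) :
    ‖transport α u v T ψ σ - ψ σ‖ ^ 2 ≤ T * ∫ t in (0 : ℝ)..T,
      ‖magneticGrad α ψ (sphMap (h.rotation t) σ)
        (rotField u v (sphMap (h.rotation t) σ))‖ ^ 2 := by
  have h0 : rotCLM u v 0 (σ : Space n) = σ := by simp [rotCLM_apply]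
  have key := norm_sq_parallel_sub_le hα (γ := fun t => rotCLM u v t (σ : Space n))
    (X := rotField u v) (Ψ := radialExt ψ) (h.hasDerivAt_rotCLM (σ : Space n))
    (fun t => (contDiffAt_radialExt hψ (sphere_ne_zero (sphMap (h.rotation t) σ))).of_le
      (by simp)) hT
  simp only [h0, radialExt_coe] at key
  have hval : ∀ t, radialExt ψ (rotCLM u v t (σ : Space n)) = ψ (sphMap (h.rotation t) σ) :=
    fun t => radialExt_coe ψ (sphMap (h.rotation t) σ)
  simp only [hval] at key
  rw [transport, hval]
  exact key

end KeyEstimate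

/-! ### The spectral gap caused by a nontrivial holonomy -/

section Gap

variable {n : ℕ} {u v : Space n} {α : Space n → Space n →L[ℝ] ℝ} {ψ : Sph n → ℂ}

instance : IsFiniteMeasure (surfaceMeasure n) := by
  unfold surfaceMeasure
  infer_instance

lemma integrable_of_continuous {F : Type*} [NormedAddCommGroup F] {f : Sph n → F}
    (hf : Continuous f) : Integrable f (surfaceMeasure n) :=
  hf.integrable_of_hasCompactSupport (HasCompactSupport.of_compactSpace f)

lemma continuous_tangentialNormSq {L : Sph n → Space n →L[ℝ] ℂ} (hL : Continuous L) :
    Continuous fun σ => tangentialNormSq σ (L σ) := by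
  simp only [tangentialNormSq_eq_sub]
  refine Continuous.sub (continuous_finsetSum _ fun i _ => ?_) ?_
  · exact ((hL.clm_apply continuous_const).norm).pow 2
  · exact ((hL.clm_apply continuous_subtype_val).norm).pow 2

/-- The magnetic energy `∫ |(d - i α) ψ|²`. -/
def energy (α : Space n → Space n →L[ℝ] ℝ) (ψ : Sph n → ℂ) : ℝ :=
  ∫ σ, tangentialNormSq σ (magneticGrad α ψ σ) ∂(surfaceMeasure n)

/-- The squared `L²` norm. -/
def mass (ψ : Sph n → ℂ) : ℝ := ∫ σ, ‖ψ σ‖ ^ 2 ∂(surfaceMeasure n)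

lemma energy_nonneg (α : Space n → Space n →L[ℝ] ℝ) (ψ : Sph n → ℂ) : 0 ≤ energy α ψ :=
  integral_nonneg fun σ => tangentialNormSq_nonneg σ _

lemma mass_nonneg (ψ : Sph n → ℂ) : 0 ≤ mass ψ := integral_nonneg fun _ => sq_nonneg _

lemma continuous_covDiff {X : Type*} [TopologicalSpace X] {a : X → Space n →L[ℝ] ℝ} {z : X → ℂ}
    {β : X → Space n →L[ℝ] ℂ} (ha : Continuous a) (hz : Continuous z) (hβ : Continuous β) :
    Continuous fun x => covDiff (a x) (z x) (β x) := by
  refine hβ.sub ((continuous_const.mul hz).smul ?_)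
  exact ((ContinuousLinearMap.compL ℝ (Space n) ℝ ℂ) Complex.ofRealCLM).continuous.comp ha

lemma continuous_magneticGrad (hα : Continuous α) (hψ : ContMDiff (𝓡 n) 𝓘(ℝ, ℂ) ∞ ψ) :
    Continuous (magneticGrad α ψ) :=
  continuous_covDiff (hα.comp continuous_subtype_val) hψ.continuous
    (continuous_fderiv_radialExt hψ)

lemma transport_eq (h : IsOrthonormalPair u v) (T : ℝ) (σ : Sph n) :
    transport α u v T ψ σ =
      Complex.exp (-(Complex.I * holonomy α u v T (σ : Space n))) * ψ (sphMap (h.rotation T) σ) :=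
  congrArg (_ * ·) (radialExt_coe ψ (sphMap (h.rotation T) σ))

lemma continuous_transport (hα : Continuous α) (h : IsOrthonormalPair u v) (T : ℝ)
    (hψ : Continuous ψ) : Continuous (transport α u v T ψ) := by
  have h1 : Continuous fun σ : Sph n => holonomy α u v T (σ : Space n) :=
    (continuous_holonomy hα u v T).comp continuous_subtype_val
  have h2 : Continuous fun σ : Sph n =>
      Complex.exp (-(Complex.I * holonomy α u v T (σ : Space n))) :=
    Complex.continuous_exp.comp
      (continuous_const.mul (Complex.continuous_ofReal.comp h1)).neg
  have h3 := h2.mul (hψ.comp (continuous_sphMap (h.rotation T)))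
  exact h3.congr fun σ => (transport_eq h T σ).symm

lemma continuous_orbit (h : IsOrthonormalPair u v) :
    Continuous fun p : Sph n × ℝ => sphMap (h.rotation p.2) p.1 := by
  refine Continuous.subtype_mk ?_ _
  change Continuous fun p : Sph n × ℝ => rotCLM u v p.2 (p.1 : Space n)
  simp only [rotCLM_apply]
  fun_prop

/-- Averaging over orbits of rotations does not change integrals over the sphere. -/
lemma integral_orbit {D : Sph n → ℝ} (hD : Continuous D) (h : IsOrthonormalPair u v) (T : ℝ) :
    ∫ σ, (∫ t in (0 : ℝ)..T, D (sphMap (h.rotation t) σ)) ∂(surfaceMeasure n) =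
      T * ∫ σ, D σ ∂(surfaceMeasure n) := by
  have hc : Continuous fun p : Sph n × ℝ => D (sphMap (h.rotation p.2) p.1) :=
    hD.comp (continuous_orbit h)
  have hint : Integrable (Function.uncurry fun (t : ℝ) (σ : Sph n) => D (sphMap (h.rotation t) σ))
      ((volume.restrict (Set.uIoc 0 T)).prod (surfaceMeasure n)) := by
    have h1 : (volume.restrict (Set.uIoc 0 T)).prod (surfaceMeasure n) =
        ((volume : Measure ℝ).prod (surfaceMeasure n)).restrict
          (Set.uIoc 0 T ×ˢ (Set.univ : Set (Sph n))) := by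
      rw [← Measure.prod_restrict, Measure.restrict_univ]
    rw [h1]
    have h2 : IntegrableOn
        (Function.uncurry fun (t : ℝ) (σ : Sph n) => D (sphMap (h.rotation t) σ))
        (Set.uIcc 0 T ×ˢ (Set.univ : Set (Sph n)))
        ((volume : Measure ℝ).prod (surfaceMeasure n)) :=
      (hc.comp continuous_swap).continuousOn.integrableOn_compact
        (isCompact_uIcc.prod isCompact_univ)
    exact h2.mono_set (Set.prod_mono Set.uIoc_subset_uIcc subset_rfl)
  rw [← intervalIntegral_integral_swap hint]
  have h3 : ∀ t : ℝ, ∫ σ, D (sphMap (h.rotation t) σ) ∂(surfaceMeasure n) =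
      ∫ σ, D σ ∂(surfaceMeasure n) := fun t =>
    (measurePreserving_sphMap (h.rotation t)).integral_comp (measurableEmbedding_sphMap _) D
  simp only [h3]
  simp

/-- Parallel transport along rotations by a fixed angle is close to the identity on functions of
small energy. -/
lemma integral_transport_sub_le (hα : Continuous α) (h : IsOrthonormalPair u v)
    (hψ : ContMDiff (𝓡 n) 𝓘(ℝ, ℂ) ∞ ψ) {T : ℝ} (hT : 0 ≤ T) :
    ∫ σ, ‖transport α u v T ψ σ - ψ σ‖ ^ 2 ∂(surfaceMeasure n) ≤ T ^ 2 * energy α ψ := by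
  set D : Sph n → ℝ := fun σ => tangentialNormSq σ (magneticGrad α ψ σ) with hDdef
  have hD : Continuous D := continuous_tangentialNormSq (continuous_magneticGrad hα hψ)
  have hc : Continuous fun p : Sph n × ℝ => D (sphMap (h.rotation p.2) p.1) :=
    hD.comp (continuous_orbit h)
  have hpt : ∀ σ, ‖transport α u v T ψ σ - ψ σ‖ ^ 2 ≤
      T * ∫ t in (0 : ℝ)..T, D (sphMap (h.rotation t) σ) := by
    intro σ
    have horb : Continuous fun t : ℝ => sphMap (h.rotation t) σ :=
      Continuous.comp (g := fun p : Sph n × ℝ => sphMap (h.rotation p.2) p.1)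
        (f := fun t : ℝ => (σ, t)) (continuous_orbit h) (Continuous.prodMk_right σ)
    refine (norm_sq_transport_sub_le hα h hψ hT σ).trans ?_
    refine mul_le_mul_of_nonneg_left ?_ hT
    refine intervalIntegral.integral_mono_on hT ?_ ?_ fun t _ => ?_
    · refine Continuous.intervalIntegrable ?_ _ _
      refine (Continuous.norm ?_).pow 2
      exact Continuous.clm_apply (f := fun t => magneticGrad α ψ (sphMap (h.rotation t) σ))
        ((continuous_magneticGrad hα hψ).comp horb)
        ((rotField u v).continuous.comp (continuous_subtype_val.comp horb))
    · exact (hD.comp horb).intervalIntegrable _ _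
    · set τ := sphMap (h.rotation t) σ
      refine (norm_sq_apply_le τ (magneticGrad α ψ τ) (inner_self_rotField u v τ)).trans ?_
      refine mul_le_of_le_one_left (tangentialNormSq_nonneg τ _) ?_
      have := h.norm_rotField_le (τ : Space n)
      rw [norm_sphere] at this
      exact pow_le_one₀ (norm_nonneg _) this
  have hcI : Continuous fun σ => ∫ t in (0 : ℝ)..T, D (sphMap (h.rotation t) σ) :=
    intervalIntegral.continuous_parametric_intervalIntegral_of_continuous'
      (f := fun (σ : Sph n) (t : ℝ) => D (sphMap (h.rotation t) σ)) hc 0 T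
  calc ∫ σ, ‖transport α u v T ψ σ - ψ σ‖ ^ 2 ∂(surfaceMeasure n)
      ≤ ∫ σ, T * (∫ t in (0 : ℝ)..T, D (sphMap (h.rotation t) σ)) ∂(surfaceMeasure n) := by
        refine integral_mono (integrable_of_continuous ?_) (integrable_of_continuous ?_) hpt
        · exact ((continuous_transport hα h T hψ.continuous).sub hψ.continuous).norm.pow 2
        · exact continuous_const.mul hcI
    _ = T ^ 2 * energy α ψ := by
        rw [integral_const_mul, integral_orbit hD h T, energy]
        ring

/-- The set `N` carries a negligible part of the mass of functions whose energy is small compared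
with their mass. -/
def IsDispersive (α : Space n → Space n →L[ℝ] ℝ) (N : Set (Sph n)) : Prop :=
  ∀ ε : ℝ, 0 < ε → ∃ δ : ℝ, 0 < δ ∧ ∀ ψ : Sph n → ℂ, ContMDiff (𝓡 n) 𝓘(ℝ, ℂ) ∞ ψ →
    energy α ψ ≤ δ * mass ψ → ∫ σ in N, ‖ψ σ‖ ^ 2 ∂(surfaceMeasure n) ≤ ε * mass ψ

lemma integrable_norm_sq (hψ : Continuous ψ) :
    Integrable (fun σ => ‖ψ σ‖ ^ 2) (surfaceMeasure n) :=
  integrable_of_continuous (hψ.norm.pow 2)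

lemma IsDispersive.mono {N N' : Set (Sph n)} (hN : IsDispersive α N') (hsub : N ⊆ N') :
    IsDispersive α N := by
  intro ε hε
  obtain ⟨δ, hδ, H⟩ := hN ε hε
  refine ⟨δ, hδ, fun ψ hψ hE => (?_ : _ ≤ _).trans (H ψ hψ hE)⟩
  exact setIntegral_mono_set (integrable_norm_sq hψ.continuous).integrableOn
    (Filter.Eventually.of_forall fun _ => sq_nonneg _) hsub.eventuallyLE

lemma IsDispersive.union {N N' : Set (Sph n)} (hN : IsDispersive α N) (hN' : IsDispersive α N') :
    IsDispersive α (N ∪ N') := by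
  intro ε hε
  obtain ⟨δ, hδ, H⟩ := hN (ε / 2) (half_pos hε)
  obtain ⟨δ', hδ', H'⟩ := hN' (ε / 2) (half_pos hε)
  refine ⟨min δ δ', lt_min hδ hδ', fun ψ hψ hE => ?_⟩
  have h1 := H ψ hψ (hE.trans (mul_le_mul_of_nonneg_right (min_le_left _ _) (mass_nonneg ψ)))
  have h2 := H' ψ hψ (hE.trans (mul_le_mul_of_nonneg_right (min_le_right _ _) (mass_nonneg ψ)))
  have hint := integrable_norm_sq hψ.continuous
  have h3 := integral_mono_measure (f := fun σ => ‖ψ σ‖ ^ 2)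
    (Measure.restrict_union_le (μ := surfaceMeasure n) N N')
    (Filter.Eventually.of_forall fun _ => sq_nonneg _)
    (Integrable.add_measure hint.integrableOn hint.integrableOn)
  rw [integral_add_measure hint.integrableOn hint.integrableOn] at h3
  linarith

/-- Parallel transport moves the mass on the preimage of `N` into `N`, up to an error bounded by the
energy. -/
lemma IsDispersive.preimage (hα : Continuous α) (h : IsOrthonormalPair u v) {T : ℝ} (hT : 0 ≤ T)
    {N : Set (Sph n)} (hN : IsDispersive α N) :
    IsDispersive α (sphMap (h.rotation T) ⁻¹' N) := by
  intro ε hε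
  obtain ⟨δ, hδ, H⟩ := hN (ε / 4) (by positivity)
  refine ⟨min δ (ε / (4 * (T ^ 2 + 1))), by positivity, fun ψ hψ hE => ?_⟩
  have hm := mass_nonneg ψ
  have h1 := H ψ hψ (hE.trans (mul_le_mul_of_nonneg_right (min_le_left _ _) hm))
  have h2 : T ^ 2 * energy α ψ ≤ ε / 4 * mass ψ := by
    have h3 := hE.trans (mul_le_mul_of_nonneg_right (min_le_right _ _) hm)
    calc T ^ 2 * energy α ψ ≤ (T ^ 2 + 1) * energy α ψ := by
          nlinarith [energy_nonneg α ψ]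
      _ ≤ (T ^ 2 + 1) * (ε / (4 * (T ^ 2 + 1)) * mass ψ) := by gcongr
      _ = ε / 4 * mass ψ := by field_simp
  have h3 := (integral_transport_sub_le hα h hψ hT).trans h2
  set R := sphMap (h.rotation T) with hR
  have hphase : ∀ σ, ‖transport α u v T ψ σ‖ = ‖ψ (R σ)‖ := by
    intro σ
    rw [transport_eq h T σ, norm_mul, Complex.norm_exp]
    simp [hR]
  have hpt : ∀ σ, ‖ψ σ‖ ^ 2 ≤ 2 * ‖ψ (R σ)‖ ^ 2 + 2 * ‖transport α u v T ψ σ - ψ σ‖ ^ 2 := by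
    intro σ
    rw [← hphase]
    have h4 := norm_le_norm_add_norm_sub (transport α u v T ψ σ) (ψ σ)
    nlinarith [sq_nonneg (‖transport α u v T ψ σ‖ - ‖transport α u v T ψ σ - ψ σ‖),
      norm_nonneg (ψ σ)]
  have hc1 : Integrable (fun σ => 2 * ‖ψ (R σ)‖ ^ 2) (surfaceMeasure n) :=
    (integrable_norm_sq (hψ.continuous.comp (continuous_sphMap _))).const_mul 2
  have hc2 : Integrable (fun σ => ‖transport α u v T ψ σ - ψ σ‖ ^ 2) (surfaceMeasure n) :=
    integrable_norm_sq ((continuous_transport hα h T hψ.continuous).sub hψ.continuous)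
  have h5 : ∫ σ in R ⁻¹' N, ‖ψ (R σ)‖ ^ 2 ∂(surfaceMeasure n) =
      ∫ σ in N, ‖ψ σ‖ ^ 2 ∂(surfaceMeasure n) :=
    (measurePreserving_sphMap (h.rotation T)).setIntegral_preimage_emb
      (measurableEmbedding_sphMap _) (fun σ => ‖ψ σ‖ ^ 2) N
  have h6 : ∫ σ in R ⁻¹' N, ‖transport α u v T ψ σ - ψ σ‖ ^ 2 ∂(surfaceMeasure n) ≤
      ∫ σ, ‖transport α u v T ψ σ - ψ σ‖ ^ 2 ∂(surfaceMeasure n) :=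
    setIntegral_le_integral hc2 (Filter.Eventually.of_forall fun _ => sq_nonneg _)
  have h7 := setIntegral_mono (s := R ⁻¹' N) (integrable_norm_sq hψ.continuous).integrableOn
    (hc1.add (hc2.const_mul 2)).integrableOn hpt
  simp only [Pi.add_apply] at h7
  rw [integral_add hc1.integrableOn (hc2.const_mul 2).integrableOn, integral_const_mul,
    integral_const_mul, h5] at h7
  linarith

/-- Near a point whose circular orbit has a nontrivial holonomy, mass costs energy. -/
lemma exists_isDispersive_nhds (hα : Continuous α) (h : IsOrthonormalPair u v) {σ₀ : Sph n}
    (hhol : Complex.exp (-(Complex.I * holonomy α u v (2 * Real.pi) (σ₀ : Space n))) ≠ 1) :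
    ∃ N ∈ 𝓝 σ₀, IsDispersive α N := by
  set c : Sph n → ℝ := fun σ =>
    ‖Complex.exp (-(Complex.I * holonomy α u v (2 * Real.pi) (σ : Space n))) - 1‖ ^ 2 with hc
  have hcc : Continuous c := by
    have h1 : Continuous fun σ : Sph n => holonomy α u v (2 * Real.pi) (σ : Space n) :=
      (continuous_holonomy hα u v (2 * Real.pi)).comp continuous_subtype_val
    exact (((Complex.continuous_exp.comp
      (continuous_const.mul (Complex.continuous_ofReal.comp h1)).neg).sub
        continuous_const).norm).pow 2
  have hc0 : 0 < c σ₀ := by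
    have := norm_pos_iff.2 (sub_ne_zero.2 hhol)
    positivity
  -- a full turn returns to the starting point, and transport multiplies by the phase
  have htr : ∀ (ψ : Sph n → ℂ) σ,
      ‖transport α u v (2 * Real.pi) ψ σ - ψ σ‖ ^ 2 = c σ * ‖ψ σ‖ ^ 2 := by
    intro ψ σ
    rw [transport, rotCLM_two_pi, radialExt_coe, ← sub_one_mul, norm_mul, mul_pow]
  have hopen : IsOpen {σ | c σ₀ / 2 < c σ} := isOpen_lt continuous_const hcc
  refine ⟨{σ | c σ₀ / 2 < c σ}, hopen.mem_nhds (half_lt_self hc0), fun ε hε => ?_⟩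
  refine ⟨ε * (c σ₀ / 2) / (2 * Real.pi) ^ 2, by positivity, fun ψ hψ hE => ?_⟩
  have h1 := integral_transport_sub_le hα h hψ (T := 2 * Real.pi) (by positivity)
  have h2 : (2 * Real.pi) ^ 2 * energy α ψ ≤ ε * (c σ₀ / 2) * mass ψ := by
    calc (2 * Real.pi) ^ 2 * energy α ψ
        ≤ (2 * Real.pi) ^ 2 * (ε * (c σ₀ / 2) / (2 * Real.pi) ^ 2 * mass ψ) := by gcongr
      _ = ε * (c σ₀ / 2) * mass ψ := by field_simp
  simp only [htr] at h1
  have hint : Integrable (fun σ => c σ * ‖ψ σ‖ ^ 2) (surfaceMeasure n) :=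
    integrable_of_continuous (hcc.mul (hψ.continuous.norm.pow 2))
  have h3 : (c σ₀ / 2) * ∫ σ in {σ | c σ₀ / 2 < c σ}, ‖ψ σ‖ ^ 2 ∂(surfaceMeasure n) ≤
      ∫ σ, c σ * ‖ψ σ‖ ^ 2 ∂(surfaceMeasure n) := by
    rw [← integral_const_mul]
    refine (setIntegral_mono_on ((integrable_norm_sq hψ.continuous).const_mul _).integrableOn
      hint.integrableOn hopen.measurableSet fun σ hσ => ?_).trans
      (setIntegral_le_integral hint (Filter.Eventually.of_forall fun σ => ?_))
    · exact mul_le_mul_of_nonneg_right (le_of_lt hσ) (sq_nonneg _)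
    · exact mul_nonneg (sq_nonneg _) (sq_nonneg _)
  have h4 := (h3.trans h1).trans h2
  have h5 : 0 < c σ₀ / 2 := half_pos hc0
  refine le_of_mul_le_mul_left (h4.trans_eq ?_) h5
  ring

/-- A nontrivial holonomy around a single circle forces a spectral gap. -/
theorem exists_spectral_gap (hn : 1 ≤ n) (hα : Continuous α) (h : IsOrthonormalPair u v)
    {σ₀ : Sph n}
    (hhol : Complex.exp (-(Complex.I * holonomy α u v (2 * Real.pi) (σ₀ : Space n))) ≠ 1) :
    ∃ δ : ℝ, 0 < δ ∧ ∀ ψ : Sph n → ℂ, ContMDiff (𝓡 n) 𝓘(ℝ, ℂ) ∞ ψ → δ * mass ψ ≤ energy α ψ := by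
  obtain ⟨N, hN, hNd⟩ := exists_isDispersive_nhds hα h hhol
  have huniv : IsDispersive α (Set.univ : Set (Sph n)) := by
    refine isCompact_univ.induction_on (p := IsDispersive α) ?_ (fun s t hst ht => ht.mono hst)
      (fun s t hs ht => hs.union ht) fun σ _ => ?_
    · intro ε hε
      refine ⟨1, one_pos, fun ψ _ _ => ?_⟩
      rw [setIntegral_empty]
      exact mul_nonneg hε.le (mass_nonneg ψ)
    -- rotate a given point to `σ₀`
    · obtain ⟨w, hw, t, ht, hrot⟩ := exists_rotation (E := Space n) (by simpa using hn)
        (norm_sphere σ) (norm_sphere σ₀)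
      have hR : sphMap (hw.rotation t) σ = σ₀ := Subtype.ext hrot
      refine ⟨sphMap (hw.rotation t) ⁻¹' N, mem_nhdsWithin_of_mem_nhds ?_,
        hNd.preimage hα hw ht⟩
      refine (continuous_sphMap (hw.rotation t)).continuousAt.preimage_mem_nhds ?_
      rwa [hR]
  -- applied to the whole sphere, dispersivity with `ε < 1` excludes mass altogether
  obtain ⟨δ, hδ, H⟩ := huniv (1 / 2) (by norm_num)
  refine ⟨δ, hδ, fun ψ hψ => ?_⟩
  by_contra! hlt
  have h1 := H ψ hψ hlt.le
  rw [setIntegral_univ] at h1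
  change mass ψ ≤ _ at h1
  have h2 : mass ψ = 0 := le_antisymm (by linarith) (mass_nonneg ψ)
  rw [h2, mul_zero] at hlt
  exact absurd (energy_nonneg α ψ) (not_le.2 hlt)

end Gap

/-! ### Holonomies of small circles and the exterior derivative -/

section SmallCircles

variable {E : Type} [NormedAddCommGroup E] [InnerProductSpace ℝ E] {u v x : E}
  {α : E → E →L[ℝ] ℝ}

/-- The point at angle `t` on the circle of angular radius `ε` around `x`. -/
def circlePoint (x u v : E) (ε t : ℝ) : E :=
  Real.cos ε • x + Real.sin ε • (Real.cos t • u + Real.sin t • v)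

/-- The orbit of a point at angular distance `ε` from `x` is a circle around `x`; the holonomy
vanishes with its radius. -/
lemma holonomy_circle (h : IsOrthonormalPair u v) (hu : inner ℝ u x = 0) (hv : inner ℝ v x = 0)
    (T ε : ℝ) :
    holonomy α u v T (Real.cos ε • x + Real.sin ε • u) = Real.sin ε *
      ∫ t in (0 : ℝ)..T, α (circlePoint x u v ε t) (Real.cos t • v - Real.sin t • u) := by
  rw [holonomy, ← intervalIntegral.integral_const_mul]
  congr 1
  ext t
  have h1 : inner ℝ u (Real.cos ε • x + Real.sin ε • u) = Real.sin ε := by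
    rw [inner_add_right, inner_smul_right, inner_smul_right, hu, h.inner_left]
    ring
  have h2 : inner ℝ v (Real.cos ε • x + Real.sin ε • u) = 0 := by
    rw [inner_add_right, inner_smul_right, inner_smul_right, hv, h.orth']
    ring
  have h3 : rotCLM u v t (Real.cos ε • x + Real.sin ε • u) = circlePoint x u v ε t := by
    rw [rotCLM_apply, rotField_apply, h1, h2, circlePoint]
    module
  have h4 : rotField u v (rotCLM u v t (Real.cos ε • x + Real.sin ε • u)) =
      Real.sin ε • (Real.cos t • v - Real.sin t • u) := by
    rw [h.rotField_rotCLM, rotField_apply, h1, h2]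
    module
  rw [h4, h3, map_smul, smul_eq_mul]

/-- The integrand of the holonomies, divided by the radius of the circle, is smooth. -/
lemma contDiff_circle (hα : ContDiff ℝ ∞ α) : ContDiff ℝ ∞ fun p : ℝ × ℝ =>
    α (circlePoint x u v p.1 p.2) (Real.cos p.2 • v - Real.sin p.2 • u) := by
  have h1 : ContDiff ℝ ∞ fun p : ℝ × ℝ => circlePoint x u v p.1 p.2 := by
    unfold circlePoint
    fun_prop
  exact (hα.comp h1).clm_apply (by fun_prop)

lemma integral_quadratic (a b c d : ℝ) :
    ∫ t in (0 : ℝ)..2 * Real.pi, (Real.cos t ^ 2 * a + Real.sin t * Real.cos t * b -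
      Real.sin t ^ 2 * c + Real.sin t * Real.cos t * d) = Real.pi * (a - c) := by
  rw [intervalIntegral.integral_add, intervalIntegral.integral_sub, intervalIntegral.integral_add]
  · simp only [intervalIntegral.integral_mul_const, integral_cos_sq, integral_sin_sq,
      integral_sin_mul_cos₁]
    simp
    ring
  all_goals exact Continuous.intervalIntegrable (by fun_prop) _ _

/-- If the holonomies around all circles about `x` in the directions of the plane of `u` and `v`
are trivial, the exterior derivative of `α` at `x` vanishes on this plane: it is the limit of
the holonomies divided by the enclosed areas. -/
lemma fderiv_symm_of_holonomy (hα : ContDiff ℝ ∞ α) (h : IsOrthonormalPair u v)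
    (hu : inner ℝ u x = 0) (hv : inner ℝ v x = 0)
    (hhol : ∀ ε : ℝ, Complex.exp (-(Complex.I *
      holonomy α u v (2 * Real.pi) (Real.cos ε • x + Real.sin ε • u))) = 1) :
    fderiv ℝ α x u v = fderiv ℝ α x v u := by
  set G : ℝ × ℝ → ℝ := fun p =>
    α (circlePoint x u v p.1 p.2) (Real.cos p.2 • v - Real.sin p.2 • u) with hG
  have hGs : ContDiff ℝ ∞ G := contDiff_circle hα
  set k : ℝ → ℝ := fun ε => ∫ t in (0 : ℝ)..2 * Real.pi, G (ε, t) with hk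
  have hkd := hasFDerivAt_parametric_integral (hGs.of_le (by simp)) 0 (2 * Real.pi) (0 : ℝ)
  have hkc : Continuous k := (contDiff_parametric_integral hGs 0 (2 * Real.pi)).continuous
  have hhk : ∀ ε, holonomy α u v (2 * Real.pi) (Real.cos ε • x + Real.sin ε • u) =
      Real.sin ε * k ε := holonomy_circle h hu hv _
  -- the holonomies are multiples of `2 π` and small, so they vanish
  have hzero : k =ᶠ[𝓝 0] fun _ => 0 := by
    refine (ContinuousAt.eventuallyEq_nhds_iff_eventuallyEq_nhdsNE hkc.continuousAt
      continuousAt_const).1 ?_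
    have hc : Continuous fun ε => |Real.sin ε * k ε| := (Real.continuous_sin.mul hkc).abs
    have h1 : ∀ᶠ ε in 𝓝[≠] (0 : ℝ), |Real.sin ε * k ε| < 2 * Real.pi := by
      refine nhdsWithin_le_nhds (hc.continuousAt.eventually_lt continuousAt_const ?_)
      simp [Real.pi_pos]
    have h2 : ∀ᶠ ε in 𝓝[≠] (0 : ℝ), |ε| < Real.pi := by
      refine nhdsWithin_le_nhds (continuous_abs.continuousAt.eventually_lt continuousAt_const ?_)
      simp [Real.pi_pos]
    filter_upwards [h1, h2, self_mem_nhdsWithin] with ε hε1 hε2 hε3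
    have hsin : Real.sin ε ≠ 0 := by
      rw [abs_lt] at hε2
      rw [Ne, Real.sin_eq_zero_iff_of_lt_of_lt hε2.1 hε2.2]
      exact hε3
    obtain ⟨m, hm⟩ := Complex.exp_eq_one_iff.1 (hhol ε)
    rw [hhk] at hm
    have hm' : -(Real.sin ε * k ε) = m * (2 * Real.pi) := by
      have h3 : Complex.I * ((-(Real.sin ε * k ε) : ℝ) : ℂ) =
          Complex.I * ((m * (2 * Real.pi) : ℝ) : ℂ) := by
        push_cast
        push_cast at hm
        linear_combination hm
      exact_mod_cast mul_left_cancel₀ Complex.I_ne_zero h3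
    have hm0 : m = 0 := by
      rw [← abs_neg, hm', abs_mul, abs_of_pos Real.two_pi_pos] at hε1
      have : |(m : ℝ)| < 1 := by
        by_contra! hge
        nlinarith [Real.two_pi_pos]
      have h5 : |m| < 1 := by exact_mod_cast this
      exact Int.abs_lt_one_iff.1 h5
    rw [hm0, Int.cast_zero, zero_mul, neg_eq_zero] at hm'
    exact (mul_eq_zero.1 hm').resolve_left hsin
  -- the derivative at `ε = 0` of the holonomy divided by the radius involves only the first
  -- derivative of `α` at `x`
  have hder : ∀ t, (fderiv ℝ G (0, t)) (1, 0) =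
      fderiv ℝ α x (Real.cos t • u + Real.sin t • v) (Real.cos t • v - Real.sin t • u) := by
    intro t
    have h1 : HasDerivAt (fun ε : ℝ => circlePoint x u v ε t)
        (Real.cos t • u + Real.sin t • v) 0 := by
      have := ((Real.hasDerivAt_cos 0).smul_const x).add
        ((Real.hasDerivAt_sin 0).smul_const (Real.cos t • u + Real.sin t • v))
      refine HasDerivAt.congr_deriv (f := fun ε : ℝ => circlePoint x u v ε t) this ?_
      simp
    have h0 : circlePoint x u v 0 t = x := by simp [circlePoint]
    have h2 : HasDerivAt (fun ε : ℝ => α (circlePoint x u v ε t))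
        (fderiv ℝ α x (Real.cos t • u + Real.sin t • v)) 0 := by
      have h3 : HasFDerivAt α (fderiv ℝ α x) (circlePoint x u v 0 t) := by
        rw [h0]
        exact (hα.differentiable (by simp) x).hasFDerivAt
      exact h3.comp_hasDerivAt (0 : ℝ) h1
    have h4 := h2.clm_apply (hasDerivAt_const (0 : ℝ) (Real.cos t • v - Real.sin t • u))
    have h5 : HasDerivAt (fun ε : ℝ => G (ε, t)) ((fderiv ℝ G (0, t)) (1, 0)) 0 :=
      HasFDerivAt.comp_hasDerivAt (f := fun ε : ℝ => (ε, t)) (0 : ℝ)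
        ((hGs.differentiable (by simp) (0, t)).hasFDerivAt)
        ((hasDerivAt_id (0 : ℝ)).prodMk (hasDerivAt_const (0 : ℝ) t))
    rw [h5.unique h4]
    simp
  have hk0 : (∫ t in (0 : ℝ)..2 * Real.pi,
      (fderiv ℝ G (0, t)).comp (ContinuousLinearMap.inl ℝ ℝ ℝ)) = 0 :=
    hkd.unique ((hasFDerivAt_const (0 : ℝ) (0 : ℝ)).congr_of_eventuallyEq hzero)
  have hk1 : ∫ t in (0 : ℝ)..2 * Real.pi, (fderiv ℝ G (0, t)) (1, 0) = 0 := by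
    have h1 := congrArg (fun L : ℝ →L[ℝ] ℝ => L 1) hk0
    have hcont : Continuous fun t : ℝ =>
        (fderiv ℝ G (0, t)).comp (ContinuousLinearMap.inl ℝ ℝ ℝ) :=
      ((hGs.continuous_fderiv (by simp)).comp (by fun_prop : Continuous fun t : ℝ =>
        ((0 : ℝ), t))).clm_comp continuous_const
    rw [ContinuousLinearMap.intervalIntegral_apply (hcont.intervalIntegrable _ _)] at h1
    simpa using h1
  simp only [hder, map_add, map_sub, map_smul, _root_.add_apply, _root_.smul_apply,
    smul_eq_mul] at hk1
  have h6 := integral_quadratic (fderiv ℝ α x u v) (fderiv ℝ α x v v) (fderiv ℝ α x v u)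
    (-fderiv ℝ α x u u)
  have h7 : Real.pi * (fderiv ℝ α x u v - fderiv ℝ α x v u) = 0 := by
    rw [← h6, ← hk1]
    congr 1
    ext t
    ring
  have := (mul_eq_zero.1 h7).resolve_left Real.pi_ne_zero
  linarith

end SmallCircles

section GapOfField

variable {n : ℕ}

/-- If a 1-form is not closed on the sphere, its magnetic Laplacian has a spectral gap. -/
theorem exists_spectral_gap_of_not_closed (hn : 1 ≤ n) {α : Space n → Space n →L[ℝ] ℝ}
    (hα : ContDiff ℝ ∞ α) {u v : Space n} (h : IsOrthonormalPair u v) (σ : Sph n)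
    (hu : inner ℝ u (σ : Space n) = 0) (hv : inner ℝ v (σ : Space n) = 0)
    (hne : fderiv ℝ α σ u v ≠ fderiv ℝ α σ v u) :
    ∃ δ : ℝ, 0 < δ ∧ ∀ ψ : Sph n → ℂ, ContMDiff (𝓡 n) 𝓘(ℝ, ℂ) ∞ ψ → δ * mass ψ ≤ energy α ψ := by
  have h1 := mt (fderiv_symm_of_holonomy hα h hu hv) hne
  push Not at h1
  obtain ⟨ε, hε⟩ := h1
  have hnorm : ‖Real.cos ε • (σ : Space n) + Real.sin ε • u‖ = 1 := by
    have h2 : inner ℝ (Real.cos ε • (σ : Space n) + Real.sin ε • u)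
        (Real.cos ε • (σ : Space n) + Real.sin ε • u) = 1 := by
      have h3 : inner ℝ (σ : Space n) (σ : Space n) = 1 := by
        rw [real_inner_self_eq_norm_sq, norm_sphere, one_pow]
      simp only [inner_add_left, inner_add_right, real_inner_smul_left, real_inner_smul_right,
        hu, h.inner_left, real_inner_comm u (σ : Space n), h3]
      linear_combination Real.sin_sq_add_cos_sq ε
    rw [real_inner_self_eq_norm_sq] at h2
    exact (pow_eq_one_iff_of_nonneg (norm_nonneg _) two_ne_zero).1 h2
  exact exists_spectral_gap hn hα.continuous h
    (σ₀ := ⟨Real.cos ε • (σ : Space n) + Real.sin ε • u, by simpa using hnorm⟩) hε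

end GapOfField

/-! ### Functions of class `H¹` -/

section Sobolev

variable {n : ℕ} {α : Space n → Space n →L[ℝ] ℝ} {φ ψ : Sph n → ℂ} {G : Sph n → Space n →L[ℝ] ℂ}

lemma tangentialNormSq_le (σ : Sph n) (L : Space n →L[ℝ] ℂ) :
    tangentialNormSq σ L ≤ n * ‖L‖ ^ 2 := by
  rw [tangentialNormSq_eq]
  calc ∑ μ, ‖L (modelIsometry σ (EuclideanSpace.single μ 1))‖ ^ 2
      ≤ ∑ _μ : Fin n, ‖L‖ ^ 2 := by
        gcongr with μ
        refine (L.le_opNorm _).trans_eq ?_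
        rw [(modelIsometry σ).norm_map]
        simp
    _ = n * ‖L‖ ^ 2 := by simp

lemma tangentialNormSq_add_le (σ : Sph n) (L₁ L₂ L₃ : Space n →L[ℝ] ℂ) :
    tangentialNormSq σ (L₁ + L₂ + L₃) ≤
      3 * (tangentialNormSq σ L₁ + tangentialNormSq σ L₂ + tangentialNormSq σ L₃) := by
  simp only [tangentialNormSq_eq, ← Finset.sum_add_distrib, Finset.mul_sum]
  refine Finset.sum_le_sum fun μ _ => ?_
  set w := modelIsometry σ (EuclideanSpace.single μ 1)
  have h := norm_add₃_le (a := L₁ w) (b := L₂ w) (c := L₃ w)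
  have h2 : ‖(L₁ + L₂ + L₃) w‖ ^ 2 ≤ (‖L₁ w‖ + ‖L₂ w‖ + ‖L₃ w‖) ^ 2 := by
    gcongr
    exact h
  nlinarith [sq_nonneg (‖L₁ w‖ - ‖L₂ w‖), sq_nonneg (‖L₁ w‖ - ‖L₃ w‖),
    sq_nonneg (‖L₂ w‖ - ‖L₃ w‖)]

lemma norm_covDiff_zero_le (a : Space n →L[ℝ] ℝ) (z : ℂ) : ‖covDiff a z 0‖ ≤ ‖a‖ * ‖z‖ := by
  refine ContinuousLinearMap.opNorm_le_bound _ (by positivity) fun v => ?_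
  rw [covDiff_apply, _root_.zero_apply, zero_sub, norm_neg, norm_mul, norm_mul, Complex.norm_I,
    one_mul, Complex.norm_real]
  calc ‖z‖ * ‖a v‖ ≤ ‖z‖ * (‖a‖ * ‖v‖) := by
        gcongr
        exact a.le_opNorm v
    _ = ‖a‖ * ‖z‖ * ‖v‖ := by ring

lemma covDiff_eq_add (a : Space n →L[ℝ] ℝ) (z w : ℂ) (β γ : Space n →L[ℝ] ℂ) :
    covDiff a w γ = covDiff a z β + (γ - β) + covDiff a (w - z) 0 := by
  ext v
  simp only [covDiff_apply, _root_.add_apply, _root_.sub_apply, _root_.zero_apply]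
  ring

lemma aestronglyMeasurable_of_continuous {F : Type*} [NormedAddCommGroup F]
    {f : Sph n → F} (hf : Continuous f) : AEStronglyMeasurable f (surfaceMeasure n) :=
  (integrable_of_continuous hf).aestronglyMeasurable

lemma integrable_tangentialNormSq (hG : MemLp G 2 (surfaceMeasure n)) :
    Integrable (fun σ => tangentialNormSq σ (G σ)) (surfaceMeasure n) := by
  have hm : AEStronglyMeasurable (fun σ => tangentialNormSq σ (G σ)) (surfaceMeasure n) := by
    simp only [tangentialNormSq_eq_sub]
    have h1 : ∀ {f : Sph n → Space n}, Continuous f →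
        AEStronglyMeasurable (fun σ => ‖G σ (f σ)‖ ^ 2) (surfaceMeasure n) := fun hf =>
      (((ContinuousLinearMap.id ℝ (Space n →L[ℝ] ℂ)).aestronglyMeasurable_comp₂ hG.1
        (aestronglyMeasurable_of_continuous hf)).norm).pow 2
    refine AEStronglyMeasurable.sub ?_ (h1 continuous_subtype_val)
    exact Finset.aestronglyMeasurable_fun_sum _ fun i _ => h1 continuous_const
  refine (((memLp_two_iff_integrable_sq_norm hG.1).1 hG).const_mul (n : ℝ)).mono' hm ?_
  refine Filter.Eventually.of_forall fun σ => ?_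
  rw [Real.norm_of_nonneg (tangentialNormSq_nonneg σ _)]
  exact tangentialNormSq_le σ _

lemma memLp_covDiff (hα : Continuous α) (hφ : MemLp φ 2 (surfaceMeasure n))
    (hG : MemLp G 2 (surfaceMeasure n)) :
    MemLp (fun σ : Sph n => covDiff (α σ) (φ σ) (G σ)) 2 (surfaceMeasure n) := by
  obtain ⟨M, hM⟩ := isCompact_univ.exists_bound_of_continuousOn
    (hα.comp (continuous_subtype_val (p := (· ∈ Metric.sphere (0 : Space n) 1)))).continuousOn
  have h1 : MemLp (fun σ : Sph n => (Complex.I * φ σ) • Complex.ofRealCLM.comp (α σ)) 2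
      (surfaceMeasure n) := by
    refine MemLp.of_le_mul (c := M) hφ ?_ (Filter.Eventually.of_forall fun σ => ?_)
    · refine (hφ.1.const_mul Complex.I).smul (aestronglyMeasurable_of_continuous ?_)
      exact ((ContinuousLinearMap.compL ℝ (Space n) ℝ ℂ) Complex.ofRealCLM).continuous.comp
        (hα.comp continuous_subtype_val)
    · have h2 := norm_covDiff_zero_le (α σ) (φ σ)
      rw [covDiff, zero_sub, norm_neg] at h2
      exact h2.trans (by gcongr; exact hM σ trivial)
  exact hG.sub h1

lemma memLp_of_continuous {F : Type*} [NormedAddCommGroup F] {f : Sph n → F} (hf : Continuous f) :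
    MemLp f 2 (surfaceMeasure n) :=
  hf.memLp_of_hasCompactSupport (HasCompactSupport.of_compactSpace f)

lemma tendsto_integral_of_lintegral {f : ℕ → Sph n → ℝ}
    (hf : ∀ k, Integrable (f k) (surfaceMeasure n)) (h0 : ∀ k σ, 0 ≤ f k σ)
    (h : Filter.Tendsto (fun k => ∫⁻ σ, ENNReal.ofReal (f k σ) ∂(surfaceMeasure n))
      Filter.atTop (𝓝 0)) :
    Filter.Tendsto (fun k => ∫ σ, f k σ ∂(surfaceMeasure n)) Filter.atTop (𝓝 0) := by
  have h1 := (ENNReal.tendsto_toReal ENNReal.zero_ne_top).comp h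
  rw [ENNReal.toReal_zero] at h1
  refine h1.congr fun k => ?_
  rw [integral_eq_lintegral_of_nonneg_ae (Filter.Eventually.of_forall (h0 k)) (hf k).1]
  rfl

lemma covectorNormSq_mvfderiv_sub (hψ : ContMDiff (𝓡 n) 𝓘(ℝ, ℂ) ∞ ψ) (σ : Sph n) :
    covectorNormSq σ (mvfderiv (𝓡 n) ψ σ - restrictTangent G σ) =
      tangentialNormSq σ (fderiv ℝ (radialExt ψ) σ - G σ) := by
  rw [mvfderiv_eq_radialExt hψ]
  rfl

lemma covectorNormSq_magneticDiff (B : Space n → Space n [⋀^Fin 2]→L[ℝ] ℝ) (r : ℝ) (σ : Sph n) :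
    covectorNormSq σ (magneticDiff B r σ (φ σ) (restrictTangent G σ)) =
      tangentialNormSq σ (covDiff (scaledPotential B r σ) (φ σ) (G σ)) := by
  rw [restrictTangent, magneticDiff_restrict]
  rfl

/-- Functions of class `H¹` are approximated by smooth functions, so that they inherit the lower
bound on the energy up to a constant. -/
lemma mass_le_of_isSobolev (hα : Continuous α) {δ : ℝ} (hδ : 0 ≤ δ)
    (hgap : ∀ ψ : Sph n → ℂ, ContMDiff (𝓡 n) 𝓘(ℝ, ℂ) ∞ ψ → δ * mass ψ ≤ energy α ψ)
    (h : IsSobolev φ G) :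
    δ / 6 * mass φ ≤ ∫ σ : Sph n, tangentialNormSq σ (covDiff (α σ) (φ σ) (G σ))
      ∂(surfaceMeasure n) := by
  obtain ⟨hφ, hG, ψ, hψ, hψ0, hψ1⟩ := h
  obtain ⟨M, hM⟩ := isCompact_univ.exists_bound_of_continuousOn
    (hα.comp (continuous_subtype_val (p := (· ∈ Metric.sphere (0 : Space n) 1)))).continuousOn
  set dψ : ℕ → Sph n → Space n →L[ℝ] ℂ := fun k σ => fderiv ℝ (radialExt (ψ k)) σ with hdψ
  have hdL : ∀ k, MemLp (dψ k) 2 (surfaceMeasure n) := fun k =>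
    memLp_of_continuous (continuous_fderiv_radialExt (hψ k))
  have hψL : ∀ k, MemLp (ψ k) 2 (surfaceMeasure n) := fun k =>
    memLp_of_continuous (hψ k).continuous
  have hi0 : ∀ k, Integrable (fun σ => ‖ψ k σ - φ σ‖ ^ 2) (surfaceMeasure n) := fun k =>
    (memLp_two_iff_integrable_sq_norm ((hψL k).sub hφ).1).1 ((hψL k).sub hφ)
  have hi1 : ∀ k, Integrable (fun σ => tangentialNormSq σ (dψ k σ - G σ)) (surfaceMeasure n) :=
    fun k => integrable_tangentialNormSq ((hdL k).sub hG)
  have hiφ : Integrable (fun σ => ‖φ σ‖ ^ 2) (surfaceMeasure n) :=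
    (memLp_two_iff_integrable_sq_norm hφ.1).1 hφ
  have hiD : Integrable (fun σ : Sph n => tangentialNormSq σ (covDiff (α σ) (φ σ) (G σ)))
      (surfaceMeasure n) := integrable_tangentialNormSq (memLp_covDiff hα hφ hG)
  have ht0 := tendsto_integral_of_lintegral hi0 (fun _ _ => sq_nonneg _) hψ0
  have ht1 := tendsto_integral_of_lintegral hi1 (fun _ σ => tangentialNormSq_nonneg σ _) (by
    simp only [covectorNormSq_mvfderiv_sub (hψ _)] at hψ1
    exact hψ1)
  set a : ℕ → ℝ := fun k => ∫ σ, ‖ψ k σ - φ σ‖ ^ 2 ∂(surfaceMeasure n) with ha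
  set b : ℕ → ℝ := fun k => ∫ σ, tangentialNormSq σ (dψ k σ - G σ) ∂(surfaceMeasure n) with hb
  set I := ∫ σ : Sph n, tangentialNormSq σ (covDiff (α σ) (φ σ) (G σ)) ∂(surfaceMeasure n) with hI
  set C : ℝ := n * M ^ 2 with hC
  have hmass : ∀ k, mass φ ≤ 2 * mass (ψ k) + 2 * a k := by
    intro k
    have hi := integrable_norm_sq (hψ k).continuous
    rw [mass, mass, ha, ← integral_const_mul, ← integral_const_mul,
      ← integral_add (hi.const_mul 2) ((hi0 k).const_mul 2)]
    refine integral_mono hiφ ((hi.const_mul 2).add ((hi0 k).const_mul 2)) fun σ => ?_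
    have h4 := norm_le_norm_add_norm_sub (ψ k σ) (φ σ)
    change ‖φ σ‖ ^ 2 ≤ 2 * ‖ψ k σ‖ ^ 2 + 2 * ‖ψ k σ - φ σ‖ ^ 2
    nlinarith [sq_nonneg (‖ψ k σ‖ - ‖ψ k σ - φ σ‖), norm_nonneg (φ σ)]
  have henergy : ∀ k, energy α (ψ k) ≤ 3 * (I + b k + C * a k) := by
    intro k
    have hiC := (hi0 k).const_mul C
    have hiDb : Integrable (fun σ : Sph n => tangentialNormSq σ (covDiff (α σ) (φ σ) (G σ)) +
        tangentialNormSq σ (dψ k σ - G σ)) (surfaceMeasure n) := hiD.add (hi1 k)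
    rw [energy, ha, ← integral_const_mul, hI, hb, ← integral_add hiD (hi1 k),
      ← integral_add hiDb hiC, ← integral_const_mul]
    refine integral_mono
      (integrable_of_continuous (continuous_tangentialNormSq (continuous_magneticGrad hα (hψ k))))
      ((hiDb.add hiC).const_mul 3) fun σ => ?_
    have h5 : tangentialNormSq σ (covDiff (α σ) (ψ k σ - φ σ) 0) ≤ C * ‖ψ k σ - φ σ‖ ^ 2 := by
      calc tangentialNormSq σ (covDiff (α σ) (ψ k σ - φ σ) 0)
          ≤ n * (‖α σ‖ * ‖ψ k σ - φ σ‖) ^ 2 := by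
            refine (tangentialNormSq_le σ _).trans ?_
            gcongr
            exact norm_covDiff_zero_le _ _
        _ ≤ n * (M * ‖ψ k σ - φ σ‖) ^ 2 := by
            gcongr
            exact hM σ trivial
        _ = C * ‖ψ k σ - φ σ‖ ^ 2 := by ring
    change tangentialNormSq σ (covDiff (α σ) (ψ k σ) (dψ k σ)) ≤
      3 * (tangentialNormSq σ (covDiff (α σ) (φ σ) (G σ)) + tangentialNormSq σ (dψ k σ - G σ) +
        C * ‖ψ k σ - φ σ‖ ^ 2)
    rw [covDiff_eq_add (α σ) (φ σ) (ψ k σ) (G σ)]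
    refine (tangentialNormSq_add_le σ _ _ _).trans ?_
    gcongr
  have hfinal : ∀ k, δ / 6 * mass φ ≤ I + b k + C * a k + δ / 3 * a k := by
    intro k
    have h6 := hgap (ψ k) (hψ k)
    have h7 := henergy k
    have h8 := mul_le_mul_of_nonneg_left (hmass k) hδ
    linarith
  have hlim : Filter.Tendsto (fun k => I + b k + C * a k + δ / 3 * a k) Filter.atTop
      (𝓝 (I + 0 + C * 0 + δ / 3 * 0)) :=
    ((tendsto_const_nhds.add ht1).add (ht0.const_mul C)).add (ht0.const_mul (δ / 3))
  have := ge_of_tendsto' hlim hfinal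
  simpa using this

lemma isSobolev_of_contMDiff (hψ : ContMDiff (𝓡 n) 𝓘(ℝ, ℂ) ∞ ψ) :
    IsSobolev ψ fun σ => fderiv ℝ (radialExt ψ) σ := by
  refine ⟨memLp_of_continuous hψ.continuous,
    memLp_of_continuous (continuous_fderiv_radialExt hψ), fun _ => ψ, fun _ => hψ, ?_, ?_⟩
  · simp
  · simp only [covectorNormSq_mvfderiv_sub hψ, sub_self, tangentialNormSq_eq, _root_.zero_apply]
    simp

instance : (surfaceMeasure n).IsOpenPosMeasure := by
  unfold surfaceMeasure
  infer_instance

lemma not_ae_eq_zero (hψ : Continuous ψ) (h0 : ψ ≠ 0) : ¬ (ψ =ᵐ[surfaceMeasure n] 0) :=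
  fun h => h0 ((hψ.ae_eq_iff_eq _ continuous_zero).1 h)

end Sobolev

/-! ### The ground state energy -/

section GroundState

variable {n : ℕ} {B : Space n → Space n [⋀^Fin 2]→L[ℝ] ℝ} {r : ℝ}

/-- A spectral gap on smooth functions keeps `nu` away from zero. The set defining `nu` is nonempty,
since it contains the quotient of a constant function. -/
lemma nu_pos_of_gap (hB : ContDiff ℝ ∞ B) {δ : ℝ} (hδ : 0 < δ)
    (hgap : ∀ ψ : Sph n → ℂ, ContMDiff (𝓡 n) 𝓘(ℝ, ℂ) ∞ ψ →
      δ * mass ψ ≤ energy (scaledPotential B r) ψ) : 0 < nu B r := by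
  refine lt_of_lt_of_le (by positivity : 0 < δ / 6) (le_csInf ?_ ?_)
  · have h1 : ContMDiff (𝓡 n) 𝓘(ℝ, ℂ) ∞ (fun _ : Sph n => (1 : ℂ)) := contMDiff_const
    refine ⟨_, _, _, isSobolev_of_contMDiff h1, not_ae_eq_zero continuous_const ?_, rfl⟩
    intro h
    exact one_ne_zero (congrFun h (sphProj 0))
  · rintro q ⟨φ, G, hS, hne, rfl⟩
    have hi : Integrable (fun σ => ‖φ σ‖ ^ 2) (surfaceMeasure n) :=
      (memLp_two_iff_integrable_sq_norm hS.1.1).1 hS.1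
    have hpos : 0 < ∫ σ, ‖φ σ‖ ^ 2 ∂(surfaceMeasure n) := by
      refine lt_of_le_of_ne (mass_nonneg φ) fun h0 => hne ?_
      have h1 := (integral_eq_zero_iff_of_nonneg (fun _ => sq_nonneg _) hi).1 h0.symm
      filter_upwards [h1] with σ hσ
      simpa using hσ
    rw [le_div_iff₀ hpos]
    simp only [covectorNormSq_magneticDiff]
    exact mass_le_of_isSobolev (contDiff_scaledPotential hB r).continuous hδ.le hgap hS

/-- A nonzero covariantly constant function is a minimiser. -/
lemma nu_eq_zero_of_parallel {φ : Sph n → ℂ} (hφ : ContMDiff (𝓡 n) 𝓘(ℝ, ℂ) ∞ φ) (h0 : φ ≠ 0)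
    (h : ∀ σ, magneticDiff B r σ (φ σ) (mvfderiv (𝓡 n) φ σ) = 0) : nu B r = 0 := by
  refine IsLeast.csInf_eq ⟨⟨φ, _, isSobolev_of_contMDiff hφ, not_ae_eq_zero hφ.continuous h0, ?_⟩,
    ?_⟩
  · have h1 : ∀ σ, covectorNormSq σ (magneticDiff B r σ (φ σ)
        (restrictTangent (fun σ : Sph n => fderiv ℝ (radialExt φ) σ) σ)) = 0 := by
      intro σ
      rw [restrictTangent, ← mvfderiv_eq_radialExt hφ, h, covectorNormSq_eq]
      exact Finset.sum_eq_zero fun μ _ => by simp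
    simp only [h1, integral_zero, zero_div]
  · rintro q ⟨ψ, G, -, -, rfl⟩
    refine div_nonneg (integral_nonneg fun σ => ?_) (mass_nonneg ψ)
    rw [Pi.zero_apply, covectorNormSq_magneticDiff]
    exact tangentialNormSq_nonneg σ _

lemma mvfderiv_exp {f : Sph n → ℝ} (hf : ContMDiff (𝓡 n) 𝓘(ℝ, ℝ) ∞ f) (σ : Sph n) :
    mvfderiv (𝓡 n) (fun τ => Complex.exp (Complex.I * f τ)) σ =
      (Complex.I * Complex.exp (Complex.I * f σ)) • Complex.ofRealCLM.comp
        (mvfderiv (𝓡 n) f σ) := by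
  have h1 : HasMFDerivAt (𝓡 n) 𝓘(ℝ, ℝ) f σ (mvfderiv (𝓡 n) f σ) :=
    ((hf σ).mdifferentiableAt (by simp)).hasMFDerivAt
  have h2 : HasFDerivAt (fun x : ℝ => Complex.exp (Complex.I * x))
      ((Complex.I * Complex.exp (Complex.I * f σ)) • Complex.ofRealCLM) (f σ) := by
    refine ((Complex.ofRealCLM.hasFDerivAt (x := f σ)).const_mul Complex.I).cexp.congr_fderiv ?_
    rw [smul_smul, mul_comm]
    rfl
  exact (h2.hasMFDerivAt.comp σ h1).mfderiv

/-- A primitive of the magnetic potential is the phase of a covariantly constant function. -/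
lemma exists_parallel_of_primitive {f : Sph n → ℝ} (hf : ContMDiff (𝓡 n) 𝓘(ℝ, ℝ) ∞ f)
    (h : ∀ σ, sphPotential B r σ = mvfderiv (𝓡 n) f σ) :
    ∃ φ : Sph n → ℂ, ContMDiff (𝓡 n) 𝓘(ℝ, ℂ) ∞ φ ∧ φ ≠ 0 ∧
      ∀ σ, magneticDiff B r σ (φ σ) (mvfderiv (𝓡 n) φ σ) = 0 := by
  refine ⟨fun τ => Complex.exp (Complex.I * f τ), ?_, ?_, fun σ => ?_⟩
  · have h1 : ContDiff ℝ ∞ fun x : ℝ => Complex.exp (Complex.I * x) :=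
      (contDiff_const.mul Complex.ofRealCLM.contDiff).cexp
    exact h1.contMDiff.comp hf
  · intro h0
    exact Complex.exp_ne_zero _ (congrFun h0 (sphProj 0))
  · rw [mvfderiv_exp hf, magneticDiff, h]
    exact sub_self _

/-- A closed magnetic potential on a sphere of dimension at least two is exact. -/
lemma exists_primitive_of_sphField_eq_zero (hn : 2 ≤ n) (hB : ContDiff ℝ ∞ B)
    (hclosed : ∀ x, extDeriv B x = 0) (h : ∀ σ, sphField B r σ = 0) :
    ∃ f : Sph n → ℝ, ContMDiff (𝓡 n) 𝓘(ℝ, ℝ) ∞ f ∧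
      ∀ σ, sphPotential B r σ = mvfderiv (𝓡 n) f σ := by
  obtain ⟨f, hf, hfd⟩ := exists_primitive hn (contDiff_scaledPotential hB r) (by
    intro σ v w hv hw
    obtain ⟨v, rfl⟩ := exists_tangentIncl_eq σ hv
    obtain ⟨w, rfl⟩ := exists_tangentIncl_eq σ hw
    refine sub_eq_zero.1 ?_
    rw [fderiv_scaledPotential_sub hB hclosed]
    refine (sphField_apply hB hclosed r σ v w).symm.trans ?_
    rw [h]
    rfl)
  refine ⟨f, hf, fun σ => ?_⟩
  rw [sphPotential_eq]
  exact (hfd σ).mfderiv.symm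

/-- A vanishing ground state energy forces the magnetic tensor on the sphere to vanish. -/
lemma sphField_eq_zero_of_nu_eq_zero (hn : 1 ≤ n) (hB : ContDiff ℝ ∞ B)
    (hclosed : ∀ x, extDeriv B x = 0) (h : nu B r = 0) (σ : Sph n) : sphField B r σ = 0 := by
  by_contra hne
  rw [sphField_eq_zero_iff] at hne
  push Not at hne
  obtain ⟨μ, ν, hμν⟩ := hne
  have hneq : μ ≠ ν := by
    rintro rfl
    have := twoForm_swap (E := EuclideanSpace ℝ (Fin n)) (sphField B r σ) (coordVec σ μ)
      (coordVec σ μ)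
    exact hμν (self_eq_neg.1 this)
  have hinner : ∀ i j, inner ℝ (tangentIncl σ (coordVec σ i)) (tangentIncl σ (coordVec σ j)) =
      (1 : Matrix (Fin n) (Fin n) ℝ) i j := fun i j =>
    congrFun (congrFun (roundMetric_eq_one σ) i) j
  have hunit : ∀ i, ‖tangentIncl σ (coordVec σ i)‖ = 1 := fun i => by
    have h1 := hinner i i
    rw [real_inner_self_eq_norm_sq, Matrix.one_apply_eq] at h1
    exact (pow_eq_one_iff_of_nonneg (norm_nonneg _) two_ne_zero).1 h1
  have hpair : IsOrthonormalPair (tangentIncl σ (coordVec σ μ)) (tangentIncl σ (coordVec σ ν)) :=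
    ⟨hunit μ, hunit ν, (hinner μ ν).trans (Matrix.one_apply_ne hneq)⟩
  have hperp : ∀ i, inner ℝ (tangentIncl σ (coordVec σ i)) (σ : Space n) = 0 := fun i => by
    rw [real_inner_comm]
    exact inner_self_tangentIncl σ _
  obtain ⟨δ, hδ, hgap⟩ := exists_spectral_gap_of_not_closed hn (contDiff_scaledPotential hB r)
    hpair σ (hperp μ) (hperp ν) (by
      rw [← sub_ne_zero, fderiv_scaledPotential_sub hB hclosed]
      exact fun h0 => hμν ((sphField_apply hB hclosed r σ _ _).trans h0))
  exact (nu_pos_of_gap hB hδ hgap).ne' h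

lemma nu_eq_zero_of_sphField_eq_zero (hn : 2 ≤ n) (hB : ContDiff ℝ ∞ B)
    (hclosed : ∀ x, extDeriv B x = 0) (h : ∀ σ, sphField B r σ = 0) : nu B r = 0 := by
  obtain ⟨f, hf, hfd⟩ := exists_primitive_of_sphField_eq_zero hn hB hclosed h
  obtain ⟨φ, hφ, h0, hD⟩ := exists_parallel_of_primitive hf hfd
  exact nu_eq_zero_of_parallel hφ h0 hD

/-- Beyond the support of the field the sphere carries no field. -/
lemma eventually_sphField_eq_zero (hB : ContDiff ℝ ∞ B) (hclosed : ∀ x, extDeriv B x = 0)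
    (hsupp : HasCompactSupport B) : ∀ᶠ r in Filter.atTop, ∀ σ : Sph n, sphField B r σ = 0 := by
  obtain ⟨R, hR⟩ := hsupp.isCompact.isBounded.subset_closedBall 0
  filter_upwards [Filter.eventually_gt_atTop R, Filter.eventually_gt_atTop 0] with r hr hr0 σ
  rw [sphField_eq_zero_iff]
  intro μ ν
  have h0 : B (dilate r σ) = 0 := by
    refine image_eq_zero_of_notMem_tsupport fun hmem => ?_
    have h1 := hR hmem
    rw [mem_closedBall_zero_iff, dilate, norm_smul, norm_sphere, mul_one,
      Real.norm_of_nonneg hr0.le] at h1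
    exact absurd h1 (not_le.2 hr)
  refine (sphField_apply hB hclosed r σ _ _).trans ?_
  rw [h0]
  simp

end GroundState

end MagneticField
end

/-- The dimension is `d = m + 3`, so `d ≥ 3`; the sphere `S^{d-1}` has dimension `m + 2`. -/
theorem proposition1p4 (m : ℕ)
    (B : MagneticField.Space (m + 2) → MagneticField.Space (m + 2) [⋀^Fin 2]→L[ℝ] ℝ)
    (hsmooth : ContDiff ℝ ∞ B) (hclosed : ∀ x, extDeriv B x = 0)
    (hsupp : HasCompactSupport B) :
    (∀ r : ℝ, 0 < r → List.TFAE [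
      MagneticField.nu B r = 0,
      ∃ φ : MagneticField.Sph (m + 2) → ℂ, ContMDiff (𝓡 (m + 2)) 𝓘(ℝ, ℂ) ∞ φ ∧ φ ≠ 0 ∧
        ∀ σ, MagneticField.magneticDiff B r σ (φ σ) (mvfderiv (𝓡 (m + 2)) φ σ) = 0,
      ∃ f : MagneticField.Sph (m + 2) → ℝ, ContMDiff (𝓡 (m + 2)) 𝓘(ℝ, ℝ) ∞ f ∧
        ∀ σ, MagneticField.sphPotential B r σ = mvfderiv (𝓡 (m + 2)) f σ,
      ∀ σ, MagneticField.sphField B r σ = 0,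
      ∀ σ (l : Fin m → Fin (m + 2)), MagneticField.sphHodge B r σ l = 0,
      ∀ σ (l : Fin m → Fin (m + 2)),
        MagneticField.spaceHodge B r σ
          (Fin.snoc (fun i => (l i).castSucc) (Fin.last (m + 2))) = 0]) ∧
    Filter.Tendsto (fun r => MagneticField.nu B r) Filter.atTop (𝓝 0) := by
  refine ⟨fun r hr => ?_, ?_⟩
  · tfae_have 1 → 4 := MagneticField.sphField_eq_zero_of_nu_eq_zero (by omega) hsmooth hclosed
    tfae_have 4 → 3 :=
      MagneticField.exists_primitive_of_sphField_eq_zero (by omega) hsmooth hclosed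
    tfae_have 3 → 2 := fun ⟨_, hf, hfd⟩ => MagneticField.exists_parallel_of_primitive hf hfd
    tfae_have 2 → 1 := fun ⟨_, hφ, h0, hD⟩ => MagneticField.nu_eq_zero_of_parallel hφ h0 hD
    tfae_have 4 ↔ 5 := forall_congr' fun σ => MagneticField.sphField_eq_zero_iff_sphHodge r σ
    tfae_have 4 ↔ 6 := forall_congr' fun σ =>
      MagneticField.sphField_eq_zero_iff_spaceHodge hsmooth hclosed hr σ
    tfae_finish
  · refine tendsto_const_nhds.congr' ?_
    filter_upwards [MagneticField.eventually_sphField_eq_zero hsmooth hclosed hsupp] with r hr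
    exact (MagneticField.nu_eq_zero_of_sphField_eq_zero (by omega) hsmooth hclosed hr).symm
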